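/- Let $c>0$ and let $X_1,X_2,\dots$ be i.i.d. real random variables whose law has a probability density function $f$ supported on $[0,\infty)$. Assume that $f$ is twice differentiable on $(0,c)$ and on $(c,\infty)$ and that, for some $\varsigma\in(0,1]$, $f^{(2)}$ is Hölder continuous of order $\varsigma$ on each of these two intervals. Write $f_-(c)=\lim_{x\uparrow c}f(x)$, $f_+(c)=\lim_{x\downarrow c}f(x)$ and, for $j=1,2$, $f_-^{(j)}(c)=\lim_{x\uparrow c}f^{(j)}(x)$, $f_+^{(j)}(c)=\lim_{x\downarrow c}f^{(j)}(x)$ (finite limits), and assume $f_\pm(c)>0$. Let $b=b_n>0$ satisfy $b_n+(nb_n)^{-1}\to0$ as $n\to\infty$. With $\gamma(a,z)=\int_0^z t^{a-1}e^{-t}\,dt$ and $\Gamma(a,z)=\int_z^\infty t^{a-1}e^{-t}\,dt$, put $$\hat f_-(c)=\frac1n\sum_{i=1}^n\frac{X_i^{c/b}e^{-X_i/b}}{b^{c/b+1}\,\gamma(c/b+1,c/b)}\mathbf 1\{0\le X_i<c\},\qquad \hat f_+(c)=\frac1n\sum_{i=1}^n\frac{X_i^{c/b}e^{-X_i/b}}{b^{c/b+1}\,\Gamma(c/b+1,c/b)}\mathbf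 1\{X_i\ge c\}.$$ Then $\hat f_\pm(c)$ have finite second moments and, as $n\to\infty$, $$E\{\hat f_\pm(c)\}-f_\pm(c)=\pm\sqrt{\tfrac2\pi}\,c^{1/2}f_\pm^{(1)}(c)\,b^{1/2}+\Big\{\Big(1-\frac4{3\pi}\Big)f_\pm^{(1)}(c)+\frac c2f_\pm^{(2)}(c)\Big\}b+o(b).$$ In particular, the ratio of the bias to the displayed expansion (without the $o(b)$ term) tends to $1$ whenever $f_\pm^{(1)}(c)$ and $f_\pm^{(2)}(c)$ (with the sign considered) are not both zero. Moreover $$\operatorname{Var}\{\hat f_\pm(c)\}\sim\frac1{n\,b^{1/2}}\,\frac{f_\pm(c)}{\sqrt\pi\,c^{1/2}},$$ that is, the ratio of the two sides tends to $1$. Upper signs go with upper signs, lower with lower. -/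

import Mathlib

open MeasureTheory ProbabilityTheory Filter Topology Asymptotics
open scoped NNReal ENNReal

noncomputable section

/-- The lower incomplete gamma function `γ(a, z) = ∫₀^z t^(a-1) e^(-t) dt`. -/
def lowerIncGamma (a z : ℝ) : ℝ :=
  ∫ t in Set.Ioc 0 z, t ^ (a - 1) * Real.exp (-t)

/-- The upper incomplete gamma function `Γ(a, z) = ∫_z^∞ t^(a-1) e^(-t) dt`. -/
def upperIncGamma (a z : ℝ) : ℝ :=
  ∫ t in Set.Ioi z, t ^ (a - 1) * Real.exp (-t)

/-- The formula `u^(x/b) e^(-u/b) / (b^(x/b+1) Γ(x/b+1))` of the gamma kernel with design point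
`x` and smoothing parameter `b`, for `u ≥ 0`. -/
def gammaKernelFormula (x b u : ℝ) : ℝ :=
  u ^ (x / b) * Real.exp (-u / b) / (b ^ (x / b + 1) * Real.Gamma (x / b + 1))

/-- The part of the gamma kernel on `0 ≤ u < c`. -/
def gammaKernelL (c x b u : ℝ) : ℝ :=
  (Set.Ico 0 c).indicator (gammaKernelFormula x b) u

/-- The part of the gamma kernel on `u ≥ c`. -/
def gammaKernelU (c x b u : ℝ) : ℝ :=
  (Set.Ici c).indicator (gammaKernelFormula x b) u

/-- The re-normalized gamma kernel truncated to `0 ≤ u < c`. -/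
def gammaKernelMinus (c x b u : ℝ) : ℝ :=
  Real.Gamma (x / b + 1) / lowerIncGamma (x / b + 1) (c / b) * gammaKernelL c x b u

/-- The re-normalized gamma kernel truncated to `u ≥ c`. -/
def gammaKernelPlus (c x b u : ℝ) : ℝ :=
  Real.Gamma (x / b + 1) / upperIncGamma (x / b + 1) (c / b) * gammaKernelU c x b u

/-- The estimator of the left limit of the density at `c` from the first `n` observations of `X`,
with smoothing parameter `b`. -/
def fHatMinus {Ω : Type*} (X : ℕ → Ω → ℝ) (c b : ℝ) (n : ℕ) (ω : Ω) : ℝ :=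
  1 / (n : ℝ) * ∑ i ∈ Finset.range n, gammaKernelMinus c c b (X i ω)

/-- The estimator of the right limit of the density at `c` from the first `n` observations of `X`,
with smoothing parameter `b`. -/
def fHatPlus {Ω : Type*} (X : ℕ → Ω → ℝ) (c b : ℝ) (n : ℕ) (ω : Ω) : ℝ :=
  1 / (n : ℝ) * ∑ i ∈ Finset.range n, gammaKernelPlus c c b (X i ω)

/-- `X 0, X 1, …` is a random sample (independent, identically distributed real random variables)
from a distribution with probability density function `f` supported on `[0, ∞)`. -/
structure IsRandomSampleFrom {Ω : Type*} [MeasurableSpace Ω] (P : Measure Ω)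
    (X : ℕ → Ω → ℝ) (f : ℝ → ℝ) : Prop where
  measurable_density : Measurable f
  density_nonneg : ∀ x, 0 ≤ f x
  density_support : ∀ x, x < 0 → f x = 0
  measurable_sample : ∀ i, Measurable (X i)
  indep : iIndepFun X P
  law : ∀ i, P.map (X i) = volume.withDensity (fun x => ENNReal.ofReal (f x))

/-- `f` is twice differentiable on `(0, c)` and on `(c, ∞)`, and its second derivative is
Hölder continuous of some order `ς ∈ (0, 1]` on each of these two intervals. -/
def HasPiecewiseHolderSecondDeriv (f : ℝ → ℝ) (c : ℝ) : Prop :=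
  DifferentiableOn ℝ f (Set.Ioo 0 c ∪ Set.Ioi c) ∧
  DifferentiableOn ℝ (deriv f) (Set.Ioo 0 c ∪ Set.Ioi c) ∧
  ∃ L ς : ℝ≥0, 0 < ς ∧ ς ≤ 1 ∧
    HolderOnWith L ς (iteratedDeriv 2 f) (Set.Ioo 0 c) ∧
    HolderOnWith L ς (iteratedDeriv 2 f) (Set.Ioi c)

/-- The second-order bias expansion
`s √(2/π) c^(1/2) f₁ b^(1/2) + {(1 - 4/(3π)) f₁ + (c/2) f₂} b`, where `s` is a sign and `f₁`, `f₂`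
are the one-sided limits at `c` of the first and second derivatives of the density. -/
def biasExpansion (s c f₁ f₂ b : ℝ) : ℝ :=
  s * √(2 / Real.pi) * √c * f₁ * √b + ((1 - 4 / (3 * Real.pi)) * f₁ + c / 2 * f₂) * b

end

/-! The design point `c` is both the cut point and the mode of `u^(c/b) e^(-u/b)`. Put `z = c/b` and
`u = c(1 + σt)`, with `σ = 1` to the right of `c` and `σ = -1` to the left. Up to constants the
kernel becomes `q(t)^z` on `t > 0`, where `q(t) = (1 + σt)e^(-σt)` is `gammaProfile`, and the
incomplete gamma factor is exactly what gives it mass one. So both sides are one problem: as `z →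
∞`, average `g(t) = f(c + cσt)` against `q^z` (`profileMean`).

Let `M_k(z) = ∫ t^k q^z` over `t > 0`. Since `(1 + σt)q' = -tq`, integrating the derivatives of `(1
+ σt)q^z` and `t(1 + σt)q^z` gives the exact relations `z M_1 = 1 + σM_0` and `z M_2 = M_0 + 2σM_1`.
Hence only `M_0` needs analysis: rescaling `t = v/√z` and dominated convergence give `√z M_0 =
√(π/2) + (2σ/3)/√z + o(1/√z)` (`tendsto_sqrt_mul_profileMoment_zero_sub`). A second-order Taylor
expansion of `g` at `0+`, with an exponentially small contribution away from `0`, then yields the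
bias (`tendsto_mul_profileMean_sub`).

For the variance, squaring the kernel replaces `q^z` by `q^(2z)`, so the second moment is
`M_0(2z)/(c M_0(z)²)` times an average tending to `f_±(c)`. It is of order `b^(-1/2)` and dominates
the squared mean. -/

/-! ### Pointwise bounds on the profile -/

/-- The profile of the gamma kernel around its mode: `(1 + σ t) e^(-σ t)`, cut off at zero. -/
noncomputable def gammaProfile (σ t : ℝ) : ℝ :=
  max 0 (1 + σ * t) * Real.exp (-(σ * t))

lemma gammaProfile_nonneg (σ t : ℝ) : 0 ≤ gammaProfile σ t := by
  unfold gammaProfile; positivity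

@[fun_prop]
lemma continuous_gammaProfile (σ : ℝ) : Continuous (gammaProfile σ) := by
  unfold gammaProfile; fun_prop

lemma gammaProfile_le_one (σ t : ℝ) : gammaProfile σ t ≤ 1 := by
  unfold gammaProfile
  have h := Real.add_one_le_exp (σ * t)
  have h' : max 0 (1 + σ * t) ≤ Real.exp (σ * t) := max_le (Real.exp_pos _).le (by linarith)
  calc _ ≤ Real.exp (σ * t) * Real.exp (-(σ * t)) := by gcongr
    _ = 1 := by rw [← Real.exp_add]; simp

lemma gammaProfile_lt_one {σ t : ℝ} (h : σ * t ≠ 0) : gammaProfile σ t < 1 := by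
  unfold gammaProfile
  have h := Real.add_one_lt_exp h
  have h' : max 0 (1 + σ * t) < Real.exp (σ * t) := max_lt (Real.exp_pos _) (by linarith)
  calc _ < Real.exp (σ * t) * Real.exp (-(σ * t)) := by gcongr
    _ = 1 := by rw [← Real.exp_add]; simp

lemma gammaProfile_antitone {σ : ℝ} (hσ : σ = 1 ∨ σ = -1) {s t : ℝ} (hs : 0 ≤ s) (hst : s ≤ t) :
    gammaProfile σ t ≤ gammaProfile σ s := by
  unfold gammaProfile
  rcases le_or_gt (1 + σ * t) 0 with h | h
  · rw [max_eq_left h, zero_mul]; positivity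
  have hs' : 0 < 1 + σ * s := by rcases hσ with rfl | rfl <;> linarith
  rw [max_eq_right h.le, max_eq_right hs'.le]
  have hy := Real.add_one_le_exp (σ * (t - s))
  have key : 1 + σ * t ≤ (1 + σ * s) * Real.exp (σ * (t - s)) := by
    have h2 : (1 + σ * s) * (σ * (t - s) + 1) ≤ (1 + σ * s) * Real.exp (σ * (t - s)) := by gcongr
    refine le_trans ?_ h2
    -- As `σ² = 1`, `(1 + σs)(1 + σ(t - s))` exceeds `1 + σt` by exactly `s(t - s)`.
    have : 0 ≤ s * (t - s) := mul_nonneg hs (by linarith)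
    rcases hσ with rfl | rfl <;> nlinarith
  calc _ ≤ (1 + σ * s) * Real.exp (σ * (t - s)) * Real.exp (-(σ * t)) := by gcongr
    _ = _ := by rw [mul_assoc, ← Real.exp_add]; ring_nf

/-- This is `x ≤ sinh x` at `x = log (1 + t)`. -/
lemma log_one_add_le_div {t : ℝ} (ht : 0 ≤ t) : Real.log (1 + t) ≤ t - t ^ 2 / (2 * (1 + t)) := by
  have h1 : 0 < 1 + t := by linarith
  have h := Real.self_le_sinh_iff.2 (Real.log_nonneg (show (1 : ℝ) ≤ 1 + t by linarith))
  rw [Real.sinh_log h1] at h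
  refine h.trans (le_of_eq ?_)
  field_simp
  ring

lemma log_one_sub_le {t : ℝ} (ht : 0 ≤ t) (ht1 : t < 1) :
    Real.log (1 - t) ≤ -t - t ^ 2 / 2 := by
  have h := Real.hasSum_pow_div_log_of_abs_lt_one (x := t) (by rwa [abs_of_nonneg ht])
  have h2 := sum_le_hasSum (Finset.range 2) (fun i _ => by positivity) h
  norm_num [Finset.sum_range_succ] at h2
  linarith

/-- One majorant for both signs: Gaussian near `0`, but only exponential at infinity, which is the
true rate for `σ = 1`. -/
lemma gammaProfile_le_exp {σ : ℝ} (hσ : σ = 1 ∨ σ = -1) {t : ℝ} (ht : 0 ≤ t) :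
    gammaProfile σ t ≤ Real.exp (-(t ^ 2 / (2 * (1 + t)))) := by
  unfold gammaProfile
  rcases le_or_gt (1 + σ * t) 0 with h | h
  · rw [max_eq_left h, zero_mul]; positivity
  rw [max_eq_right h.le]
  calc _ = Real.exp (Real.log (1 + σ * t)) * Real.exp (-(σ * t)) := by rw [Real.exp_log h]
    _ = Real.exp (Real.log (1 + σ * t) + -(σ * t)) := by rw [Real.exp_add]
    _ ≤ _ := by
      rw [Real.exp_le_exp]
      rcases hσ with rfl | rfl
      · have := log_one_add_le_div ht
        rw [one_mul]; linarith
      · have := log_one_sub_le ht (by linarith)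
        have h3 : t ^ 2 / (2 * (1 + t)) ≤ t ^ 2 / 2 := by gcongr; linarith
        rw [show 1 + -1 * t = 1 - t by ring]
        linarith

lemma exp_neg_sq_div_le {t : ℝ} (ht : 0 ≤ t) :
    Real.exp (-(t ^ 2 / (2 * (1 + t)))) ≤ Real.exp (1 / 2) * Real.exp (-(1 / 2) * t) := by
  rw [← Real.exp_add, Real.exp_le_exp]
  have : (t - 1) / 2 ≤ t ^ 2 / (2 * (1 + t)) := by
    rw [div_le_div_iff₀ (by norm_num) (by positivity)]; nlinarith
  linarith

/-! ### Integrability of the powers of the profile -/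

lemma integrableOn_pow_mul_exp_neg_half (k : ℕ) :
    IntegrableOn (fun t : ℝ => t ^ k * Real.exp (-(1 / 2) * t)) (Set.Ioi 0) := by
  have := integrableOn_rpow_mul_exp_neg_mul_rpow (p := 1) (s := k) (b := 1 / 2)
    (by have : (0 : ℝ) ≤ k := k.cast_nonneg
        linarith) one_pos (by norm_num)
  simpa using this

lemma integrableOn_pow_mul_exp_neg_sq_div (k : ℕ) :
    IntegrableOn (fun t : ℝ => t ^ k * Real.exp (-(t ^ 2 / (2 * (1 + t))))) (Set.Ioi 0) := by
  refine ((integrableOn_pow_mul_exp_neg_half k).const_mul (Real.exp (1 / 2))).mono'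
    (by fun_prop) ?_
  refine (ae_restrict_iff' measurableSet_Ioi).2 (ae_of_all _ fun t (ht : 0 < t) => ?_)
  rw [Real.norm_of_nonneg (by positivity)]
  calc _ ≤ t ^ k * (Real.exp (1 / 2) * Real.exp (-(1 / 2) * t)) := by
        gcongr; exact exp_neg_sq_div_le ht.le
    _ = _ := by ring

lemma gammaProfile_rpow_le {σ : ℝ} {z : ℝ} (hz : 1 ≤ z) (t : ℝ) :
    gammaProfile σ t ^ z ≤ gammaProfile σ t :=
  Real.rpow_le_self_of_le_one (gammaProfile_nonneg _ _) (gammaProfile_le_one _ _) hz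

lemma integrableOn_pow_mul_gammaProfile_rpow {σ : ℝ} (hσ : σ = 1 ∨ σ = -1) {z : ℝ} (hz : 1 ≤ z)
    (k : ℕ) : IntegrableOn (fun t : ℝ => t ^ k * gammaProfile σ t ^ z) (Set.Ioi 0) := by
  refine (integrableOn_pow_mul_exp_neg_sq_div k).mono' ?_ ?_
  · refine Measurable.aestronglyMeasurable ?_
    have := (continuous_gammaProfile σ).measurable
    fun_prop
  refine (ae_restrict_iff' measurableSet_Ioi).2 (ae_of_all _ fun t (ht : 0 < t) => ?_)
  have := Real.rpow_nonneg (gammaProfile_nonneg σ t) z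
  rw [Real.norm_of_nonneg (by positivity)]
  gcongr
  exact (gammaProfile_rpow_le hz t).trans (gammaProfile_le_exp hσ ht.le)

lemma integrableOn_gammaProfile_rpow {σ : ℝ} (hσ : σ = 1 ∨ σ = -1) {z : ℝ} (hz : 1 ≤ z) :
    IntegrableOn (fun t : ℝ => gammaProfile σ t ^ z) (Set.Ioi 0) := by
  simpa using integrableOn_pow_mul_gammaProfile_rpow hσ hz 0

/-- Third-order Taylor expansion of `log (1 + x) - x` at `x = σt`; the remainder `t^4/(1 - t)` is at
most `2t^4` for `t ≤ 1/2`. -/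
lemma abs_log_gammaProfile_sub_le {σ : ℝ} (hσ : σ = 1 ∨ σ = -1) {t : ℝ} (ht : 0 ≤ t)
    (ht2 : t ≤ 1 / 2) :
    0 < gammaProfile σ t ∧
      |Real.log (gammaProfile σ t) - (-(t ^ 2 / 2) + σ * t ^ 3 / 3)| ≤ 2 * t ^ 4 := by
  have h : 0 < 1 + σ * t := by rcases hσ with rfl | rfl <;> linarith
  have hσ2 : σ ^ 2 = 1 := by rcases hσ with rfl | rfl <;> norm_num
  have habs : |-(σ * t)| = t := by
    rcases hσ with rfl | rfl <;> simp [abs_of_nonneg ht]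
  unfold gammaProfile
  rw [max_eq_right h.le]
  refine ⟨by positivity, ?_⟩
  rw [Real.log_mul h.ne' (Real.exp_pos _).ne', Real.log_exp]
  have key := Real.abs_log_sub_add_sum_range_le (x := -(σ * t)) (by rw [habs]; linarith) 3
  rw [habs] at key
  have e : Real.log (1 + σ * t) + -(σ * t) - (-(t ^ 2 / 2) + σ * t ^ 3 / 3) =
      ∑ i ∈ Finset.range 3, (-(σ * t)) ^ (i + 1) / ((i : ℝ) + 1) + Real.log (1 - -(σ * t)) := by
    norm_num [Finset.sum_range_succ]
    linear_combination (-t ^ 2 / 2 + σ * t ^ 3 / 3) * hσ2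
  rw [e]
  refine key.trans ?_
  rw [div_le_iff₀ (by linarith)]
  have : 0 ≤ t ^ 4 := by positivity
  norm_num
  nlinarith

/-! ### Comparison of the rescaled profile with a Gaussian -/

lemma abs_exp_sub_exp_le {x y m : ℝ} (hx : x ≤ m) (hy : y ≤ m) :
    |Real.exp x - Real.exp y| ≤ |x - y| * Real.exp m := by
  wlog h : y ≤ x generalizing x y
  · rw [abs_sub_comm, abs_sub_comm x]; exact this hy hx (le_of_not_ge h)
  rw [abs_of_nonneg (by simpa using h), abs_of_nonneg (by linarith)]
  have h1 := Real.add_one_le_exp (y - x)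
  have h2 : Real.exp y = Real.exp x * Real.exp (y - x) := by rw [← Real.exp_add]; ring_nf
  have h3 : Real.exp x ≤ Real.exp m := Real.exp_le_exp.2 hx
  have : 0 < Real.exp x := Real.exp_pos _
  nlinarith

lemma gammaProfile_scaled_rpow_le {σ : ℝ} (hσ : σ = 1 ∨ σ = -1) {z v : ℝ} (hz : 1 ≤ z)
    (hv : 0 ≤ v) :
    gammaProfile σ (v / √z) ^ z ≤ Real.exp (-(v ^ 2 / (2 * (1 + v)))) := by
  have hs : 1 ≤ √z := Real.one_le_sqrt.2 hz
  have hz0 : 0 < z := by linarith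
  have hsz : √z ^ 2 = z := Real.sq_sqrt hz0.le
  have hd : v / √z ≤ v := div_le_self hv hs
  calc _ ≤ Real.exp (-((v / √z) ^ 2 / (2 * (1 + v / √z)))) ^ z :=
        Real.rpow_le_rpow (gammaProfile_nonneg _ _) (gammaProfile_le_exp hσ (by positivity)) hz0.le
    _ = Real.exp (-(v ^ 2 / (2 * (1 + v / √z)))) := by
        rw [← Real.exp_mul, div_pow, hsz]; congr 1; field_simp
    _ ≤ _ := by
        rw [Real.exp_le_exp, neg_le_neg_iff]
        gcongr

/-- The majorant, free of `z`, for dominated convergence. With `t = v/√z ≤ 1/2`, the exponents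
differ by at most `2t³z`, and `√z · t³z = v³`. Otherwise `√z < 2v`, and both terms lie between `0`
and the common majorant. -/
lemma sqrt_mul_abs_gammaProfile_sub_le {σ : ℝ} (hσ : σ = 1 ∨ σ = -1) {z v : ℝ} (hz : 1 ≤ z)
    (hv : 0 < v) :
    |√z * (gammaProfile σ (v / √z) ^ z - Real.exp (-(1 / 2) * v ^ 2))| ≤
      (2 * v ^ 3 + 2 * v) * Real.exp (-(v ^ 2 / (2 * (1 + v)))) := by
  have hs : 1 ≤ √z := Real.one_le_sqrt.2 hz
  have hz0 : 0 < z := by linarith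
  have hsz : √z ^ 2 = z := Real.sq_sqrt hz0.le
  have hle := gammaProfile_scaled_rpow_le hσ hz hv.le
  have hgle : -(1 / 2) * v ^ 2 ≤ -(v ^ 2 / (2 * (1 + v))) := by
    have : v ^ 2 / (2 * (1 + v)) ≤ v ^ 2 / 2 := by gcongr; linarith
    linarith
  have hgle' := Real.exp_le_exp.2 hgle
  rw [abs_mul, abs_of_nonneg (Real.sqrt_nonneg z)]
  set E := Real.exp (-(v ^ 2 / (2 * (1 + v)))) with hE
  have hE0 : 0 < E := Real.exp_pos _
  rcases le_or_gt (v / √z) (1 / 2) with h | h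
  · set t := v / √z with ht
    have ht0 : 0 ≤ t := by positivity
    obtain ⟨hpos, hlog⟩ := abs_log_gammaProfile_sub_le hσ ht0 h
    have hv' : v = t * √z := by rw [ht]; field_simp
    have e1 : gammaProfile σ t ^ z = Real.exp (Real.log (gammaProfile σ t) * z) :=
      Real.rpow_def_of_pos hpos z
    have hle2 : Real.log (gammaProfile σ t) * z ≤ -(v ^ 2 / (2 * (1 + v))) := by
      rw [← Real.exp_le_exp, ← e1]; exact hle
    have hb := abs_exp_sub_exp_le hle2 hgle
    rw [← e1, ← hE] at hb
    have hlog2 : |Real.log (gammaProfile σ t) + t ^ 2 / 2| ≤ 2 * t ^ 3 := by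
      have h3 : |σ * t ^ 3 / 3| = t ^ 3 / 3 := by
        have : 0 ≤ t ^ 3 / 3 := by positivity
        rcases hσ with rfl | rfl
        · rw [one_mul, abs_of_nonneg this]
        · rw [show -1 * t ^ 3 / 3 = -(t ^ 3 / 3) by ring, abs_neg, abs_of_nonneg this]
      calc _ = |(Real.log (gammaProfile σ t) - (-(t ^ 2 / 2) + σ * t ^ 3 / 3)) + σ * t ^ 3 / 3| := by
            congr 1; ring
        _ ≤ 2 * t ^ 4 + t ^ 3 / 3 := by rw [← h3]; exact (abs_add_le _ _).trans (by gcongr)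
        _ ≤ _ := by nlinarith [pow_nonneg ht0 3]
    have hd : |Real.log (gammaProfile σ t) * z - -(1 / 2) * v ^ 2| ≤ 2 * t ^ 3 * z := by
      rw [hv', mul_pow, hsz, show Real.log (gammaProfile σ t) * z - -(1 / 2) * (t ^ 2 * z) =
        (Real.log (gammaProfile σ t) + t ^ 2 / 2) * z by ring, abs_mul, abs_of_pos hz0]
      gcongr
    calc _ ≤ √z * (2 * t ^ 3 * z * E) := by gcongr; exact hb.trans (by gcongr)
      _ = 2 * v ^ 3 * E := by rw [hv']; nth_rewrite 2 [← hsz]; ring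
      _ ≤ _ := by gcongr; linarith
  · have h' : √z ≤ 2 * v := by
      rw [lt_div_iff₀ (by positivity)] at h; linarith
    have hd : |gammaProfile σ (v / √z) ^ z - Real.exp (-(1 / 2) * v ^ 2)| ≤ E := by
      have h0 := Real.rpow_nonneg (gammaProfile_nonneg σ (v / √z)) z
      have h1 := Real.exp_pos (-(1 / 2) * v ^ 2)
      rw [abs_le]; constructor <;> linarith
    calc _ ≤ 2 * v * E := by gcongr
      _ ≤ _ := by
        gcongr
        have : 0 ≤ v ^ 3 := by positivity
        linarith

/-- The cubic term of `log q` survives: with `d` the log-ratio of the two terms, `√z d → σv³/3`, so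
`d → 0` and `√z (e^d - 1)` has the same limit. -/
lemma tendsto_sqrt_mul_gammaProfile_sub {σ : ℝ} (hσ : σ = 1 ∨ σ = -1) {v : ℝ} (hv : 0 < v) :
    Tendsto (fun z : ℝ => √z * (gammaProfile σ (v / √z) ^ z - Real.exp (-(1 / 2) * v ^ 2))) atTop
      (𝓝 (σ * (v ^ 3 / 3) * Real.exp (-(1 / 2) * v ^ 2))) := by
  have hsq : Tendsto (fun z : ℝ => √z) atTop atTop := Real.tendsto_sqrt_atTop
  have hinv : Tendsto (fun z : ℝ => (√z)⁻¹) atTop (𝓝 0) := tendsto_inv_atTop_zero.comp hsq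
  set d : ℝ → ℝ := fun z => Real.log (gammaProfile σ (v / √z)) * z + 1 / 2 * v ^ 2 with hd
  have ev : ∀ᶠ z : ℝ in atTop, 1 ≤ z ∧ v / √z ≤ 1 / 2 := by
    filter_upwards [eventually_ge_atTop 1, hsq.eventually_ge_atTop (2 * v)] with z h1 h2
    refine ⟨h1, ?_⟩
    have : 0 < √z := by positivity
    rw [div_le_iff₀ this]; linarith
  have hsd : Tendsto (fun z => √z * d z) atTop (𝓝 (σ * (v ^ 3 / 3))) := by
    rw [tendsto_iff_norm_sub_tendsto_zero]
    have h0 : Tendsto (fun z : ℝ => 2 * v ^ 4 * (√z)⁻¹) atTop (𝓝 0) := by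
      simpa using hinv.const_mul (2 * v ^ 4)
    refine squeeze_zero' (Eventually.of_forall fun _ => norm_nonneg _) ?_ h0
    filter_upwards [ev] with z ⟨h1, h2⟩
    have hz0 : 0 < z := by linarith
    have hs0 : 0 < √z := by positivity
    have hsz : √z ^ 2 = z := Real.sq_sqrt hz0.le
    obtain ⟨-, hl⟩ := abs_log_gammaProfile_sub_le hσ (t := v / √z) (by positivity) h2
    set l := Real.log (gammaProfile σ (v / √z))
    have e : √z * d z - σ * (v ^ 3 / 3) =
        √z ^ 3 * (l - (-((v / √z) ^ 2 / 2) + σ * (v / √z) ^ 3 / 3)) := by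
      have e2 : √z * d z = √z * (l * √z ^ 2 + 1 / 2 * v ^ 2) := by rw [hsz]
      rw [e2]
      field_simp
      ring
    rw [e, Real.norm_eq_abs, abs_mul, abs_of_pos (by positivity)]
    calc _ ≤ √z ^ 3 * (2 * (v / √z) ^ 4) := by gcongr
      _ = _ := by field_simp
  have hd0 : Tendsto d atTop (𝓝 0) := by
    have := hinv.mul hsd
    rw [zero_mul] at this
    refine this.congr' ?_
    filter_upwards [eventually_gt_atTop 0] with z hz
    have hs0 : 0 < √z := by positivity
    field_simp
  have hexp : Tendsto (fun z => √z * (Real.exp (d z) - 1)) atTop (𝓝 (σ * (v ^ 3 / 3))) := by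
    have hr : Tendsto (fun z => √z * (Real.exp (d z) - 1 - d z)) atTop (𝓝 0) := by
      have hb : Tendsto (fun z => |√z * d z| * |d z|) atTop (𝓝 0) := by
        simpa using hsd.abs.mul hd0.abs
      refine squeeze_zero_norm' ?_ hb
      have h1 : ∀ᶠ z in atTop, |d z| < 1 := hd0.abs.eventually_lt_const (by simp)
      filter_upwards [h1] with z hz
      have := Real.abs_exp_sub_one_sub_id_le hz.le
      rw [Real.norm_eq_abs, abs_mul, abs_mul, mul_assoc]
      gcongr
      rwa [← sq, sq_abs]
    have := hr.add hsd
    rw [zero_add] at this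
    refine this.congr fun z => ?_
    ring
  refine (hexp.mul_const (Real.exp (-(1 / 2) * v ^ 2))).congr' ?_
  filter_upwards [ev] with z ⟨h1, h2⟩
  obtain ⟨hp, -⟩ := abs_log_gammaProfile_sub_le hσ (t := v / √z) (by positivity) h2
  rw [Real.rpow_def_of_pos hp, mul_assoc, sub_mul, ← Real.exp_add, one_mul]
  simp only [hd]
  ring_nf

/-! ### Moments of the profile and expansion of the total mass -/

/-- The moments of the powers of the profile over the positive half-line. -/
noncomputable def profileMoment (σ : ℝ) (k : ℕ) (z : ℝ) : ℝ :=
  ∫ t in Set.Ioi 0, t ^ k * gammaProfile σ t ^ z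

lemma profileMoment_zero (σ z : ℝ) :
    profileMoment σ 0 z = ∫ t in Set.Ioi 0, gammaProfile σ t ^ z := by
  simp [profileMoment]

lemma sqrt_mul_profileMoment_zero (σ : ℝ) {z : ℝ} (hz : 0 < z) :
    √z * profileMoment σ 0 z = ∫ v in Set.Ioi 0, gammaProfile σ (v / √z) ^ z := by
  have hs : 0 < √z := by positivity
  have := integral_comp_mul_right_Ioi (fun t => gammaProfile σ t ^ z) 0 (inv_pos.2 hs)
  simp only [zero_mul, inv_inv, smul_eq_mul] at this
  rw [profileMoment_zero, ← this]
  rfl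

lemma integral_cube_mul_exp_neg_half_sq :
    ∫ v in Set.Ioi (0 : ℝ), v ^ 3 * Real.exp (-(1 / 2) * v ^ 2) = 2 := by
  have := integral_rpow_mul_exp_neg_mul_rpow (p := 2) (q := 3) (b := 1 / 2) (by norm_num)
    (by norm_num) (by norm_num)
  have h2 : Real.Gamma 2 = 1 := by simp
  norm_num [h2] at this
  simpa using this

lemma integrableOn_pow_mul_exp_neg_half_sq (k : ℕ) :
    IntegrableOn (fun t : ℝ => t ^ k * Real.exp (-(1 / 2) * t ^ 2)) (Set.Ioi 0) := by
  have := integrableOn_rpow_mul_exp_neg_mul_sq (b := 1 / 2) (by norm_num) (s := k)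
    (by have : (0 : ℝ) ≤ k := k.cast_nonneg
        linarith)
  simpa using this

lemma integral_exp_neg_half_sq_Ioi :
    ∫ v in Set.Ioi (0 : ℝ), Real.exp (-(1 / 2) * v ^ 2) = √(Real.pi / 2) := by
  rw [integral_gaussian_Ioi]
  have : Real.pi / (1 / 2) = 2 ^ 2 * (Real.pi / 2) := by ring
  rw [this, Real.sqrt_mul (by norm_num), Real.sqrt_sq (by norm_num)]
  ring

/-- Second-order expansion of the total mass of the powers of the profile. -/
theorem tendsto_sqrt_mul_profileMoment_zero_sub {σ : ℝ} (hσ : σ = 1 ∨ σ = -1) :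
    Tendsto (fun z : ℝ => √z * (√z * profileMoment σ 0 z - √(Real.pi / 2))) atTop
      (𝓝 (σ * (2 / 3))) := by
  have hlim : ∫ v in Set.Ioi (0 : ℝ), σ * (v ^ 3 / 3) * Real.exp (-(1 / 2) * v ^ 2) =
      σ * (2 / 3) := by
    have : ∀ v : ℝ, σ * (v ^ 3 / 3) * Real.exp (-(1 / 2) * v ^ 2) =
      σ / 3 * (v ^ 3 * Real.exp (-(1 / 2) * v ^ 2)) := fun v => by ring
    simp_rw [this]
    rw [integral_const_mul, integral_cube_mul_exp_neg_half_sq]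
    ring
  rw [← hlim]
  have hint : Tendsto (fun z : ℝ => ∫ v in Set.Ioi (0 : ℝ),
      √z * (gammaProfile σ (v / √z) ^ z - Real.exp (-(1 / 2) * v ^ 2))) atTop
      (𝓝 (∫ v in Set.Ioi (0 : ℝ), σ * (v ^ 3 / 3) * Real.exp (-(1 / 2) * v ^ 2))) := by
    refine tendsto_integral_filter_of_dominated_convergence
      (fun v => (2 * v ^ 3 + 2 * v) * Real.exp (-(v ^ 2 / (2 * (1 + v))))) ?_ ?_ ?_ ?_
    · refine Eventually.of_forall fun z => Measurable.aestronglyMeasurable ?_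
      have := (continuous_gammaProfile σ).measurable
      fun_prop
    · filter_upwards [eventually_ge_atTop 1] with z hz
      refine (ae_restrict_iff' measurableSet_Ioi).2 (ae_of_all _ fun v (hv : 0 < v) => ?_)
      exact sqrt_mul_abs_gammaProfile_sub_le hσ hz hv
    · refine (((integrableOn_pow_mul_exp_neg_sq_div 3).const_mul 2).add
        ((integrableOn_pow_mul_exp_neg_sq_div 1).const_mul 2)).congr (ae_of_all _ fun v => ?_)
      simp only [Pi.add_apply]
      ring
    · refine (ae_restrict_iff' measurableSet_Ioi).2 (ae_of_all _ fun v (hv : 0 < v) => ?_)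
      exact tendsto_sqrt_mul_gammaProfile_sub hσ hv
  refine hint.congr' ?_
  filter_upwards [eventually_ge_atTop 1] with z hz
  have hz0 : 0 < z := by linarith
  have hs : 0 < √z := by positivity
  have hi : IntegrableOn (fun v => gammaProfile σ (v / √z) ^ z) (Set.Ioi 0) := by
    have := (integrableOn_Ioi_comp_mul_right_iff (fun t => gammaProfile σ t ^ z) 0
      (inv_pos.2 hs)).2 (by simpa using integrableOn_gammaProfile_rpow hσ hz)
    exact this
  have hg : IntegrableOn (fun v : ℝ => Real.exp (-(1 / 2) * v ^ 2)) (Set.Ioi 0) := by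
    simpa using integrableOn_pow_mul_exp_neg_half_sq 0
  rw [integral_const_mul, integral_sub hi hg, sqrt_mul_profileMoment_zero σ hz0,
    integral_exp_neg_half_sq_Ioi]

/-! ### Exact relations between the moments -/

/-- Gives differentiability across `t = 1`, where the profile with `σ = -1` is cut off, so one
integration over the half-line serves both signs. -/
lemma hasDerivAt_max_zero_rpow {p : ℝ} (hp : 1 < p) (x : ℝ) :
    HasDerivAt (fun x : ℝ => max 0 x ^ p) (p * max 0 x ^ (p - 1)) x := by
  rcases lt_trichotomy x 0 with hx | rfl | hx
  · rw [max_eq_left hx.le, Real.zero_rpow (by linarith), mul_zero]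
    refine (hasDerivAt_const x (0 : ℝ)).congr_of_eventuallyEq ?_
    filter_upwards [eventually_lt_nhds hx] with y hy
    rw [max_eq_left hy.le, Real.zero_rpow (by linarith)]
  · have h := Real.hasDerivAt_rpow_const (x := 0) (p := p) (Or.inr hp.le)
    rw [max_self, Real.zero_rpow (by linarith), mul_zero] at *
    rw [hasDerivAt_iff_isLittleO] at *
    simp only [smul_zero, sub_zero, max_self, Real.zero_rpow (show p ≠ 0 by linarith)] at *
    have h2 : Tendsto (fun x : ℝ => |x|) (𝓝 0) (𝓝 0) := by
      simpa using (continuous_abs.tendsto (0 : ℝ))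
    have h3 := (h.comp_tendsto h2).norm_right
    refine (IsBigO.of_bound 1 (Eventually.of_forall fun y => ?_)).trans_isLittleO
      (h3.trans_isBigO (IsBigO.of_bound 1 (Eventually.of_forall fun y => ?_)))
    · have : max 0 y ≤ |y| := max_le (abs_nonneg _) (le_abs_self _)
      have h0 : 0 ≤ max 0 y := le_max_left _ _
      simp only [Function.comp_apply, one_mul]
      rw [Real.norm_of_nonneg (by positivity), Real.norm_of_nonneg (by positivity)]
      exact Real.rpow_le_rpow h0 this (by linarith)
    · simp
  · have h := Real.hasDerivAt_rpow_const (x := x) (p := p) (Or.inl hx.ne')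
    rw [max_eq_right hx.le]
    refine h.congr_of_eventuallyEq ?_
    filter_upwards [eventually_gt_nhds hx] with y hy
    rw [max_eq_right hy.le]

lemma gammaProfile_rpow_eq (σ z t : ℝ) :
    gammaProfile σ t ^ z = max 0 (1 + σ * t) ^ z * Real.exp (-(σ * t) * z) := by
  unfold gammaProfile
  rw [Real.mul_rpow (le_max_left _ _) (Real.exp_pos _).le, ← Real.exp_mul]

lemma one_add_mul_gammaProfile_rpow {z : ℝ} (hz : 1 ≤ z) (σ t : ℝ) :
    (1 + σ * t) * gammaProfile σ t ^ z =
      max 0 (1 + σ * t) ^ (z + 1) * Real.exp (-(σ * t) * z) := by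
  rw [gammaProfile_rpow_eq]
  rcases le_or_gt (1 + σ * t) 0 with h | h
  · rw [max_eq_left h, Real.zero_rpow (by linarith), Real.zero_rpow (by linarith)]; ring
  · rw [max_eq_right h.le, Real.rpow_add_one h.ne']; ring

/-- The factor `1 + σt` keeps the derivative in the span of `q^z` and `t q^z`, because `(1 + σt)q' =
-tq`; it also raises the exponent of the cut-off factor to `z + 1 > 1`. -/
lemma hasDerivAt_one_add_mul_gammaProfile_rpow {σ : ℝ} (hσ : σ = 1 ∨ σ = -1) {z : ℝ}
    (hz : 1 ≤ z) (t : ℝ) :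
    HasDerivAt (fun t => (1 + σ * t) * gammaProfile σ t ^ z)
      (σ * gammaProfile σ t ^ z - z * (t * gammaProfile σ t ^ z)) t := by
  have hσ2 : σ ^ 2 = 1 := by rcases hσ with rfl | rfl <;> norm_num
  have h1 : HasDerivAt (fun t => 1 + σ * t) σ t := by
    simpa using ((hasDerivAt_id t).const_mul σ).const_add 1
  have h2 : HasDerivAt (fun t => -(σ * t) * z) (-σ * z) t := by
    simpa using (((hasDerivAt_id t).const_mul σ).neg).mul_const z
  have h3 := ((hasDerivAt_max_zero_rpow (p := z + 1) (by linarith) _).comp t h1).mul h2.exp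
  simp_rw [one_add_mul_gammaProfile_rpow hz]
  refine h3.congr_deriv ?_
  have e := one_add_mul_gammaProfile_rpow hz σ t
  simp only [Function.comp_apply, add_sub_cancel_right]
  have e2 := gammaProfile_rpow_eq σ z t
  linear_combination (-σ * z) * e.symm - (z + 1) * σ * e2 +
    (-z * t * gammaProfile σ t ^ z) * hσ2

/-- Integrability of both `F` and `F'` forces `F → 0` at infinity, leaving only the boundary term at
`0`. -/
lemma integral_Ioi_deriv_eq_neg {F F' : ℝ → ℝ} (h : ∀ t, HasDerivAt F (F' t) t)
    (hF : IntegrableOn F (Set.Ioi 0)) (hF' : IntegrableOn F' (Set.Ioi 0)) :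
    ∫ t in Set.Ioi 0, F' t = -F 0 := by
  have h0 := tendsto_zero_of_hasDerivAt_of_integrableOn_Ioi (a := 0) (fun x _ => h x) hF' hF
  rw [integral_Ioi_of_hasDerivAt_of_tendsto' (fun x _ => h x) hF' h0, zero_sub]

lemma gammaProfile_zero (σ : ℝ) : gammaProfile σ 0 = 1 := by simp [gammaProfile]

lemma mul_profileMoment_one {σ : ℝ} (hσ : σ = 1 ∨ σ = -1) {z : ℝ} (hz : 1 ≤ z) :
    z * profileMoment σ 1 z = 1 + σ * profileMoment σ 0 z := by
  have i0 := integrableOn_gammaProfile_rpow hσ hz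
  have i1 := integrableOn_pow_mul_gammaProfile_rpow hσ hz 1
  simp only [pow_one] at i1
  have h := integral_Ioi_deriv_eq_neg (hasDerivAt_one_add_mul_gammaProfile_rpow hσ hz)
    ((i0.add (i1.const_mul σ)).congr (ae_of_all _ fun t => by simp only [Pi.add_apply]; ring))
    ((i0.const_mul σ).sub (i1.const_mul z))
  rw [integral_sub (i0.const_mul σ) (i1.const_mul z), integral_const_mul, integral_const_mul,
    gammaProfile_zero] at h
  simp only [profileMoment, pow_one, pow_zero, one_mul]
  simp at h
  linarith

/-- The extra factor `t` removes the boundary term at `0`. -/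
lemma mul_profileMoment_two {σ : ℝ} (hσ : σ = 1 ∨ σ = -1) {z : ℝ} (hz : 1 ≤ z) :
    z * profileMoment σ 2 z = profileMoment σ 0 z + 2 * σ * profileMoment σ 1 z := by
  have i0 := integrableOn_gammaProfile_rpow hσ hz
  have i1 := integrableOn_pow_mul_gammaProfile_rpow hσ hz 1
  have i2 := integrableOn_pow_mul_gammaProfile_rpow hσ hz 2
  have hd : ∀ t : ℝ, HasDerivAt (fun t => t * ((1 + σ * t) * gammaProfile σ t ^ z))
      (gammaProfile σ t ^ z + 2 * σ * (t ^ 1 * gammaProfile σ t ^ z) -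
        z * (t ^ 2 * gammaProfile σ t ^ z)) t := fun t =>
    ((hasDerivAt_id t).mul (hasDerivAt_one_add_mul_gammaProfile_rpow hσ hz t)).congr_deriv
      (by simp only [id]; ring)
  have h := integral_Ioi_deriv_eq_neg hd
    ((i1.add (i2.const_mul σ)).congr (ae_of_all _ fun t => by simp only [Pi.add_apply]; ring))
    ((i0.add (i1.const_mul (2 * σ))).sub (i2.const_mul z))
  have i01 : IntegrableOn (fun t => gammaProfile σ t ^ z +
    2 * σ * (t ^ 1 * gammaProfile σ t ^ z)) (Set.Ioi 0) := i0.add (i1.const_mul (2 * σ))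
  rw [integral_sub i01 (i2.const_mul z), integral_add i0 (i1.const_mul (2 * σ)), integral_const_mul, integral_const_mul] at h
  rw [profileMoment_zero]
  simp only [profileMoment]
  simp only [zero_mul, neg_zero] at h
  linarith

/-! ### Asymptotics of the normalized moments -/

lemma tendsto_sqrt_mul_profileMoment_zero {σ : ℝ} (hσ : σ = 1 ∨ σ = -1) :
    Tendsto (fun z : ℝ => √z * profileMoment σ 0 z) atTop (𝓝 √(Real.pi / 2)) := by
  have hinv : Tendsto (fun z : ℝ => (√z)⁻¹) atTop (𝓝 0) :=
    tendsto_inv_atTop_zero.comp Real.tendsto_sqrt_atTop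
  have h := (hinv.mul (tendsto_sqrt_mul_profileMoment_zero_sub hσ)).add_const √(Real.pi / 2)
  rw [zero_mul, zero_add] at h
  refine h.congr' ?_
  filter_upwards [eventually_gt_atTop 0] with z hz
  have hs0 : 0 < √z := by positivity
  field_simp
  ring

lemma profileMoment_zero_pos {σ : ℝ} (hσ : σ = 1 ∨ σ = -1) {z : ℝ}
    (hi : IntegrableOn (fun t => gammaProfile σ t ^ z) (Set.Ioi 0)) :
    0 < profileMoment σ 0 z := by
  rw [profileMoment_zero]
  refine (setIntegral_pos_iff_support_of_nonneg_ae
    (ae_of_all _ fun t => Real.rpow_nonneg (gammaProfile_nonneg _ _) _) hi).2 ?_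
  refine lt_of_lt_of_le (b := volume (Set.Ioo (0 : ℝ) 1)) (by simp) (measure_mono fun t ht => ?_)
  refine ⟨?_, ht.1⟩
  have : 0 < 1 + σ * t := by rcases hσ with rfl | rfl <;> linarith [ht.1, ht.2]
  have : 0 < gammaProfile σ t := by
    unfold gammaProfile; rw [max_eq_right this.le]; positivity
  exact (Real.rpow_pos_of_pos this z).ne'

/-- With `κ = √(π/2)`, the difference equals `-√z(√z M_0 - κ)/(√z M_0 κ)`, so the limit is
`-(2σ/3)/(π/2)`. -/
lemma tendsto_inv_profileMoment_zero_sub {σ : ℝ} (hσ : σ = 1 ∨ σ = -1) :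
    Tendsto (fun z : ℝ => (profileMoment σ 0 z)⁻¹ - √(2 / Real.pi) * √z) atTop
      (𝓝 (-σ * (4 / (3 * Real.pi)))) := by
  have hπ := Real.pi_pos
  set κ := √(Real.pi / 2) with hκ
  have hκ0 : 0 < κ := by positivity
  have hκ2 : κ ^ 2 = Real.pi / 2 := Real.sq_sqrt (by positivity)
  have hκi : √(2 / Real.pi) = κ⁻¹ := by rw [hκ, ← Real.sqrt_inv, inv_div]
  have h := (tendsto_sqrt_mul_profileMoment_zero_sub hσ).neg.div
    ((tendsto_sqrt_mul_profileMoment_zero hσ).mul_const κ) (by positivity)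
  rw [← hκ, ← sq, hκ2] at h
  have e : -(σ * (2 / 3)) / (Real.pi / 2) = -σ * (4 / (3 * Real.pi)) := by field_simp; ring
  rw [e] at h
  refine h.congr' ?_
  filter_upwards [eventually_ge_atTop 1] with z hz
  have hM := profileMoment_zero_pos hσ (integrableOn_gammaProfile_rpow hσ hz)
  have hs0 : 0 < √z := by positivity
  simp only [Pi.div_apply]
  rw [hκi]
  field_simp
  ring

/-- Second-order expansion of the mean of the normalized powers of the profile. -/
theorem tendsto_profileMoment_one_div_sub {σ : ℝ} (hσ : σ = 1 ∨ σ = -1) :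
    Tendsto (fun z : ℝ => z * (profileMoment σ 1 z / profileMoment σ 0 z) -
      √(2 / Real.pi) * √z) atTop (𝓝 (σ * (1 - 4 / (3 * Real.pi)))) := by
  -- The first moment relation reads `z M_1/M_0 = 1/M_0 + σ`.
  have h := (tendsto_inv_profileMoment_zero_sub hσ).add_const σ
  rw [show -σ * (4 / (3 * Real.pi)) + σ = σ * (1 - 4 / (3 * Real.pi)) by ring] at h
  refine h.congr' ?_
  filter_upwards [eventually_ge_atTop 1] with z hz
  have hM := profileMoment_zero_pos hσ (integrableOn_gammaProfile_rpow hσ hz)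
  rw [mul_div_assoc', mul_profileMoment_one hσ hz]
  field_simp
  ring

lemma tendsto_profileMoment_one_div {σ : ℝ} (hσ : σ = 1 ∨ σ = -1) :
    Tendsto (fun z : ℝ => profileMoment σ 1 z / profileMoment σ 0 z) atTop (𝓝 0) := by
  have hinv : Tendsto (fun z : ℝ => (√z)⁻¹) atTop (𝓝 0) :=
    tendsto_inv_atTop_zero.comp Real.tendsto_sqrt_atTop
  have h := (tendsto_inv_atTop_zero.mul (tendsto_profileMoment_one_div_sub hσ)).add
    (hinv.const_mul √(2 / Real.pi))
  simp only [zero_mul, mul_zero, add_zero] at h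
  refine h.congr' ?_
  filter_upwards [eventually_gt_atTop 0] with z hz
  have hs0 : 0 < √z := by positivity
  have hsz : √z ^ 2 = z := Real.sq_sqrt hz.le
  generalize profileMoment σ 1 z / profileMoment σ 0 z = m
  rw [← hsz, Real.sqrt_sq hs0.le]
  field_simp
  ring

lemma tendsto_mul_profileMoment_two_div {σ : ℝ} (hσ : σ = 1 ∨ σ = -1) :
    Tendsto (fun z : ℝ => z * (profileMoment σ 2 z / profileMoment σ 0 z)) atTop (𝓝 1) := by
  have h := ((tendsto_profileMoment_one_div hσ).const_mul (2 * σ)).const_add 1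
  rw [mul_zero, add_zero] at h
  refine h.congr' ?_
  filter_upwards [eventually_ge_atTop 1] with z hz
  have hM := profileMoment_zero_pos hσ (integrableOn_gammaProfile_rpow hσ hz)
  rw [mul_div_assoc' z, mul_profileMoment_two hσ hz]
  field_simp

/-- Controls the mass away from `0`: `z/M_0` grows only like `z^(3/2)`, and `a^(z-1)` decays
exponentially. -/
lemma tendsto_mul_rpow_div_profileMoment {σ : ℝ} (hσ : σ = 1 ∨ σ = -1) {a : ℝ} (ha0 : 0 ≤ a)
    (ha1 : a < 1) :
    Tendsto (fun z : ℝ => z * (a ^ (z - 1) / profileMoment σ 0 z)) atTop (𝓝 0) := by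
  have h1 : Tendsto (fun z : ℝ => z ^ (3 / 2 : ℝ) * a ^ (z - 1)) atTop (𝓝 0) := by
    rcases ha0.eq_or_lt with rfl | ha
    · refine tendsto_const_nhds.congr' ?_
      filter_upwards [eventually_gt_atTop 1] with z hz
      rw [Real.zero_rpow (by linarith), mul_zero]
    · have h := (tendsto_rpow_mul_exp_neg_mul_atTop_nhds_zero (3 / 2) (-Real.log a)
        (by linarith [Real.log_neg ha ha1])).mul_const a⁻¹
      rw [zero_mul] at h
      refine h.congr fun z => ?_
      rw [Real.rpow_sub_one ha.ne', Real.rpow_def_of_pos ha, neg_neg]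
      ring
  have h := h1.div (tendsto_sqrt_mul_profileMoment_zero hσ) (by positivity)
  rw [zero_div] at h
  refine h.congr' ?_
  filter_upwards [eventually_ge_atTop 1] with z hz
  have hM := profileMoment_zero_pos hσ (integrableOn_gammaProfile_rpow hσ hz)
  have hs0 : 0 < √z := by positivity
  have hsz : z ^ (3 / 2 : ℝ) = z * √z := by
    rw [Real.sqrt_eq_rpow, show (3 / 2 : ℝ) = 1 + 1 / 2 by norm_num, Real.rpow_add (by linarith),
      Real.rpow_one]
  simp only [Pi.div_apply]
  rw [hsz]
  field_simp

/-! ### Laplace's method for averages against the profile -/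

/-- The average of a function against the normalized powers of the profile. -/
noncomputable def profileMean (σ : ℝ) (g : ℝ → ℝ) (z : ℝ) : ℝ :=
  (∫ t in Set.Ioi 0, gammaProfile σ t ^ z * g t) / profileMoment σ 0 z

lemma integrableOn_gammaProfile_rpow_mul {σ : ℝ} {z : ℝ} (hz : 1 ≤ z) {r : ℝ → ℝ}
    (hr : IntegrableOn (fun t => gammaProfile σ t * r t) (Set.Ioi 0)) :
    IntegrableOn (fun t => gammaProfile σ t ^ z * r t) (Set.Ioi 0) := by
  have e : (fun t => gammaProfile σ t ^ z * r t) =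
      fun t => gammaProfile σ t ^ (z - 1) * (gammaProfile σ t * r t) := by
    funext t
    rcases (gammaProfile_nonneg σ t).eq_or_lt with h | h
    · rw [← h, Real.zero_rpow (by linarith)]; ring
    · rw [Real.rpow_sub_one h.ne']; field_simp
  rw [e]
  refine hr.bdd_mul (c := 1) ?_ (ae_of_all _ fun t => ?_)
  · have := (continuous_gammaProfile σ).measurable
    exact Measurable.aestronglyMeasurable (by fun_prop)
  · rw [Real.norm_of_nonneg (Real.rpow_nonneg (gammaProfile_nonneg _ _) _)]
    exact Real.rpow_le_one (gammaProfile_nonneg _ _) (gammaProfile_le_one _ _) (by linarith)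

/-- On `(0, δ)` the bound `|r| ≤ εt²` costs `ε z M_2/M_0 → ε`. Beyond `δ`, monotonicity gives `q^z ≤
q(δ/2)^(z-1) q`, which is exponentially small relative to the integrable `q|r|`. -/
theorem tendsto_mul_profileMean_of_isLittleO {σ : ℝ} (hσ : σ = 1 ∨ σ = -1) {r : ℝ → ℝ}
    (hr : IntegrableOn (fun t => gammaProfile σ t * r t) (Set.Ioi 0))
    (ho : r =o[𝓝[>] 0] fun t => t ^ 2) :
    Tendsto (fun z => z * profileMean σ r z) atTop (𝓝 0) := by
  set C := ∫ t in Set.Ioi 0, |gammaProfile σ t * r t| with hC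
  have key : ∀ ε > 0, ∃ a, 0 ≤ a ∧ a < 1 ∧ ∀ z ≥ 1, |z * profileMean σ r z| ≤
      ε * (z * (profileMoment σ 2 z / profileMoment σ 0 z)) +
        C * (z * (a ^ (z - 1) / profileMoment σ 0 z)) := by
    intro ε hε
    have hev := ho.bound hε
    rw [eventually_nhdsWithin_iff, Metric.eventually_nhds_iff] at hev
    obtain ⟨δ, hδ, hδr⟩ := hev
    have hσδ : σ * (δ / 2) ≠ 0 := by
      rcases hσ with rfl | rfl
      · positivity
      · linarith
    refine ⟨gammaProfile σ (δ / 2), gammaProfile_nonneg _ _, gammaProfile_lt_one hσδ,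
      fun z hz => ?_⟩
    have hz0 : 0 < z := by linarith
    have hM := profileMoment_zero_pos hσ (integrableOn_gammaProfile_rpow hσ hz)
    have i2 := integrableOn_pow_mul_gammaProfile_rpow hσ hz 2
    have hle : |∫ t in Set.Ioi 0, gammaProfile σ t ^ z * r t| ≤
        ε * profileMoment σ 2 z + gammaProfile σ (δ / 2) ^ (z - 1) * C := by
      refine (abs_integral_le_integral_abs).trans ?_
      rw [hC, profileMoment, ← integral_const_mul, ← integral_const_mul,
        ← integral_add (i2.const_mul ε) (hr.abs.const_mul _)]
      refine setIntegral_mono_on (integrableOn_gammaProfile_rpow_mul hz hr).abs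
        ((i2.const_mul ε).add (hr.abs.const_mul _)) measurableSet_Ioi fun t (ht : 0 < t) => ?_
      have hq := gammaProfile_nonneg σ t
      have hq2 := gammaProfile_nonneg σ (δ / 2)
      have hqz := Real.rpow_nonneg hq z
      have hqz2 := Real.rpow_nonneg hq2 (z - 1)
      rw [abs_mul, abs_of_nonneg hqz]
      rcases lt_or_ge t δ with h | h
      · have := hδr (y := t) (by rw [Real.dist_eq, sub_zero, abs_of_pos ht]; exact h) ht
        rw [Real.norm_eq_abs, Real.norm_of_nonneg (by positivity)] at this
        calc _ ≤ gammaProfile σ t ^ z * (ε * t ^ 2) := by gcongr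
          _ = ε * (t ^ 2 * gammaProfile σ t ^ z) := by ring
          _ ≤ _ := le_add_of_nonneg_right (by positivity)
      · have e : gammaProfile σ t ^ z ≤ gammaProfile σ (δ / 2) ^ (z - 1) * gammaProfile σ t := by
          rcases hq.eq_or_lt with h0 | h0
          · rw [← h0, Real.zero_rpow (by linarith), mul_zero]
          · have : gammaProfile σ t ^ z = gammaProfile σ t ^ (z - 1) * gammaProfile σ t := by
              rw [Real.rpow_sub_one h0.ne']; field_simp
            rw [this]
            gcongr
            exact gammaProfile_antitone hσ (by positivity) (by linarith)
        calc _ ≤ gammaProfile σ (δ / 2) ^ (z - 1) * gammaProfile σ t * |r t| := by gcongr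
          _ = gammaProfile σ (δ / 2) ^ (z - 1) * |gammaProfile σ t * r t| := by
            rw [abs_mul, abs_of_nonneg hq]; ring
          _ ≤ _ := le_add_of_nonneg_left (by positivity)
    rw [profileMean, abs_mul, abs_div, abs_of_pos hz0, abs_of_pos hM]
    calc _ ≤ z * ((ε * profileMoment σ 2 z + gammaProfile σ (δ / 2) ^ (z - 1) * C) /
          profileMoment σ 0 z) := by gcongr
      _ = _ := by ring
  rw [Metric.tendsto_nhds]
  intro ε hε
  obtain ⟨a, ha0, ha1, ha⟩ := key (ε / 2) (by positivity)
  have hlim := ((tendsto_mul_profileMoment_two_div hσ).const_mul (ε / 2)).add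
    ((tendsto_mul_rpow_div_profileMoment hσ ha0 ha1).const_mul C)
  rw [mul_one, mul_zero, add_zero] at hlim
  filter_upwards [hlim.eventually_lt_const (show ε / 2 < ε by linarith),
    eventually_ge_atTop 1] with z h1 h2
  rw [Real.dist_eq, sub_zero]
  exact (ha z h2).trans_lt h1

/-- Linearity in `g`: the Taylor polynomial contributes `g₀ + g₁M_1/M_0 + g₂M_2/M_0`. The remainder
contains a polynomial, so it is integrable only after multiplication by `q`; this is why the
preceding theorem asks no more. -/
theorem tendsto_mul_profileMean_sub {σ : ℝ} (hσ : σ = 1 ∨ σ = -1) {g : ℝ → ℝ} {g₀ g₁ g₂ : ℝ}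
    (hg : IntegrableOn g (Set.Ioi 0))
    (ho : (fun t => g t - (g₀ + g₁ * t + g₂ * t ^ 2)) =o[𝓝[>] 0] fun t => t ^ 2) :
    Tendsto (fun z => z * (profileMean σ g z - g₀) - g₁ * √(2 / Real.pi) * √z) atTop
      (𝓝 (σ * (1 - 4 / (3 * Real.pi)) * g₁ + g₂)) := by
  have ig : IntegrableOn (fun t => gammaProfile σ t * g t) (Set.Ioi 0) := by
    refine hg.bdd_mul (c := 1) (continuous_gammaProfile σ).aestronglyMeasurable
      (ae_of_all _ fun t => ?_)
    rw [Real.norm_of_nonneg (gammaProfile_nonneg _ _)]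
    exact gammaProfile_le_one _ _
  have ip : ∀ z : ℝ, 1 ≤ z → IntegrableOn
      (fun t => gammaProfile σ t ^ z * (g₀ + g₁ * t + g₂ * t ^ 2)) (Set.Ioi 0) := fun z hz =>
    ((((integrableOn_pow_mul_gammaProfile_rpow hσ hz 0).const_mul g₀).add
      ((integrableOn_pow_mul_gammaProfile_rpow hσ hz 1).const_mul g₁)).add
      ((integrableOn_pow_mul_gammaProfile_rpow hσ hz 2).const_mul g₂)).congr
      (ae_of_all _ fun t => by simp only [Pi.add_apply]; ring)
  have ir : IntegrableOn (fun t => gammaProfile σ t * (g t - (g₀ + g₁ * t + g₂ * t ^ 2)))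
      (Set.Ioi 0) := by
    have := ip 1 le_rfl
    simp only [Real.rpow_one] at this
    exact (ig.sub this).congr (ae_of_all _ fun t => by simp only [Pi.sub_apply]; ring)
  have h := ((tendsto_mul_profileMean_of_isLittleO hσ ir ho).add
    ((tendsto_profileMoment_one_div_sub hσ).const_mul g₁)).add
    ((tendsto_mul_profileMoment_two_div hσ).const_mul g₂)
  rw [show 0 + g₁ * (σ * (1 - 4 / (3 * Real.pi))) + g₂ * 1 =
    σ * (1 - 4 / (3 * Real.pi)) * g₁ + g₂ by ring] at h
  refine h.congr' ?_
  filter_upwards [eventually_ge_atTop 1] with z hz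
  have hM := profileMoment_zero_pos hσ (integrableOn_gammaProfile_rpow hσ hz)
  have e : ∫ t in Set.Ioi 0, gammaProfile σ t ^ z * (g t - (g₀ + g₁ * t + g₂ * t ^ 2)) =
      (∫ t in Set.Ioi 0, gammaProfile σ t ^ z * g t) - (g₀ * profileMoment σ 0 z +
        g₁ * profileMoment σ 1 z + g₂ * profileMoment σ 2 z) := by
    simp_rw [mul_sub]
    rw [integral_sub (integrableOn_gammaProfile_rpow_mul hz ig) (ip z hz)]
    congr 1
    have i0 := (integrableOn_pow_mul_gammaProfile_rpow hσ hz 0).const_mul g₀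
    have i1 := (integrableOn_pow_mul_gammaProfile_rpow hσ hz 1).const_mul g₁
    have i2 := (integrableOn_pow_mul_gammaProfile_rpow hσ hz 2).const_mul g₂
    simp only [profileMoment]
    have i01 : IntegrableOn (fun t => g₀ * (t ^ 0 * gammaProfile σ t ^ z) +
      g₁ * (t ^ 1 * gammaProfile σ t ^ z)) (Set.Ioi 0) := i0.add i1
    rw [← integral_const_mul, ← integral_const_mul, ← integral_const_mul, ← integral_add i0 i1,
      ← integral_add i01 i2]
    refine integral_congr_ae (ae_of_all _ fun t => ?_)
    simp only
    ring
  rw [profileMean, profileMean, e]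
  field_simp
  ring

theorem tendsto_profileMean {σ : ℝ} (hσ : σ = 1 ∨ σ = -1) {g : ℝ → ℝ} {g₀ g₁ g₂ : ℝ}
    (hg : IntegrableOn g (Set.Ioi 0))
    (ho : (fun t => g t - (g₀ + g₁ * t + g₂ * t ^ 2)) =o[𝓝[>] 0] fun t => t ^ 2) :
    Tendsto (profileMean σ g) atTop (𝓝 g₀) := by
  have hinv : Tendsto (fun z : ℝ => (√z)⁻¹) atTop (𝓝 0) :=
    tendsto_inv_atTop_zero.comp Real.tendsto_sqrt_atTop
  have h := ((tendsto_inv_atTop_zero.mul (tendsto_mul_profileMean_sub hσ hg ho)).add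
    (hinv.const_mul (g₁ * √(2 / Real.pi)))).const_add g₀
  simp only [zero_mul, mul_zero, add_zero] at h
  refine h.congr' ?_
  filter_upwards [eventually_gt_atTop 0] with z hz
  have hs0 : 0 < √z := by positivity
  have hsz : √z ^ 2 = z := Real.sq_sqrt hz.le
  generalize profileMean σ g z = m
  rw [← hsz, Real.sqrt_sq hs0.le]
  field_simp
  ring

/-! ### One-sided Taylor expansion -/

/-- The mean value inequality on `[s, t]` with `s → 0+`; the value of `r` at `0` plays no role. -/
lemma abs_le_mul_of_abs_deriv_le {r r' : ℝ → ℝ} {t M : ℝ} (ht : 0 < t)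
    (hd : ∀ x ∈ Set.Ioc 0 t, HasDerivAt r (r' x) x) (hb : ∀ x ∈ Set.Ioc 0 t, |r' x| ≤ M)
    (h0 : Tendsto r (𝓝[>] 0) (𝓝 0)) : |r t| ≤ M * t := by
  have hM : 0 ≤ M := (abs_nonneg _).trans (hb t ⟨ht, le_rfl⟩)
  have key : ∀ s ∈ Set.Ioc 0 t, |r t - r s| ≤ M * t := fun s hs => by
    have := (convex_Ioc 0 t).norm_image_sub_le_of_norm_hasDerivWithin_le
      (fun x hx => (hd x hx).hasDerivWithinAt) hb hs ⟨ht, le_rfl⟩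
    rw [Real.norm_eq_abs, Real.norm_of_nonneg (by linarith [hs.2] : (0 : ℝ) ≤ t - s)] at this
    refine this.trans ?_
    gcongr
    linarith [hs.1]
  have hlim : Tendsto (fun s => |r t - r s|) (𝓝[>] 0) (𝓝 |r t - 0|) := (h0.const_sub _).abs
  rw [sub_zero] at hlim
  refine le_of_tendsto hlim ?_
  filter_upwards [Ioc_mem_nhdsGT ht] with s hs using key s hs

/-- A one-sided second-order Taylor expansion from the one-sided limits of the derivatives. -/
theorem isLittleO_taylor_two_of_tendsto {g g' g'' : ℝ → ℝ} {l₀ l₁ l₂ : ℝ}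
    (hd : ∀ᶠ t in 𝓝[>] 0, HasDerivAt g (g' t) t)
    (hd' : ∀ᶠ t in 𝓝[>] 0, HasDerivAt g' (g'' t) t)
    (h₀ : Tendsto g (𝓝[>] 0) (𝓝 l₀)) (h₁ : Tendsto g' (𝓝[>] 0) (𝓝 l₁))
    (h₂ : Tendsto g'' (𝓝[>] 0) (𝓝 l₂)) :
    (fun t => g t - (l₀ + l₁ * t + l₂ / 2 * t ^ 2)) =o[𝓝[>] 0] fun t => t ^ 2 := by
  rw [isLittleO_iff]
  intro ε hε
  have hid : Tendsto (fun t : ℝ => t) (𝓝[>] 0) (𝓝 0) := nhdsWithin_le_nhds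
  have hev := (hd.and hd').and ((tendsto_iff_norm_sub_tendsto_zero.1 h₂).eventually_lt_const hε)
  obtain ⟨δ, hδ, hδr⟩ := (mem_nhdsGT_iff_exists_Ioo_subset).1 hev
  rw [Set.mem_Ioi] at hδ
  -- The bound is integrated twice: `|g'' - l₂| ≤ ε` controls the remainder of `g'`, which in turn
  -- controls that of `g`.
  have hr₁ : ∀ t ∈ Set.Ioo 0 δ, |g' t - (l₁ + l₂ * t)| ≤ ε * t := fun t ht => by
    refine abs_le_mul_of_abs_deriv_le (r := fun t => g' t - (l₁ + l₂ * t))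
      (r' := fun t => g'' t - l₂) ht.1 (fun x hx => ?_) (fun x hx => ?_) ?_
    · have h := (hδr ⟨hx.1, hx.2.trans_lt ht.2⟩).1.2
      exact h.sub (by simpa using ((hasDerivAt_id x).const_mul l₂).const_add l₁)
    · exact (hδr ⟨hx.1, hx.2.trans_lt ht.2⟩).2.le
    · simpa using h₁.sub ((hid.const_mul l₂).const_add l₁)
  filter_upwards [Ioo_mem_nhdsGT hδ] with t ht
  have := abs_le_mul_of_abs_deriv_le (r := fun t => g t - (l₀ + l₁ * t + l₂ / 2 * t ^ 2))
    (r' := fun t => g' t - (l₁ + l₂ * t)) (M := ε * t) ht.1 (fun x hx => ?_) (fun x hx => ?_) ?_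
  · rw [Real.norm_eq_abs, Real.norm_of_nonneg (by positivity)]
    exact this.trans (by rw [sq, mul_assoc])
  · have h := (hδr ⟨hx.1, hx.2.trans_lt ht.2⟩).1.1
    refine h.sub ?_
    have h2 := (((hasDerivAt_id x).const_mul l₁).const_add l₀).add
      (((hasDerivAt_id x).pow 2).const_mul (l₂ / 2))
    refine h2.congr_deriv ?_
    simp only [id]
    push_cast
    ring
  · refine (hr₁ x ⟨hx.1, hx.2.trans_lt ht.2⟩).trans ?_
    gcongr
    exact hx.2
  · simpa using h₀.sub (((hid.const_mul l₁).const_add l₀).add ((hid.pow 2).const_mul (l₂ / 2)))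

lemma isLittleO_taylor_two_comp_affine {f : ℝ → ℝ} {c a l₀ l₁ l₂ : ℝ} {l : Filter ℝ}
    (hl : Tendsto (fun t => c + a * t) (𝓝[>] 0) l)
    (hd : ∀ᶠ x in l, DifferentiableAt ℝ f x) (hd' : ∀ᶠ x in l, DifferentiableAt ℝ (deriv f) x)
    (h₀ : Tendsto f l (𝓝 l₀)) (h₁ : Tendsto (deriv f) l (𝓝 l₁))
    (h₂ : Tendsto (iteratedDeriv 2 f) l (𝓝 l₂)) :
    (fun t => f (c + a * t) - (l₀ + a * l₁ * t + a ^ 2 * l₂ / 2 * t ^ 2)) =o[𝓝[>] 0]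
      fun t => t ^ 2 := by
  have e2 : iteratedDeriv 2 f = deriv (deriv f) := by
    rw [iteratedDeriv_succ, iteratedDeriv_one]
  rw [e2] at h₂
  have haff : ∀ t : ℝ, HasDerivAt (fun t => c + a * t) a t := fun t => by
    simpa using ((hasDerivAt_id t).const_mul a).const_add c
  refine isLittleO_taylor_two_of_tendsto (g := fun t => f (c + a * t))
    (g' := fun t => a * deriv f (c + a * t)) (g'' := fun t => a ^ 2 * deriv (deriv f) (c + a * t))
    ?_ ?_ (h₀.comp hl) ((h₁.comp hl).const_mul a) ((h₂.comp hl).const_mul (a ^ 2))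
  · filter_upwards [hl.eventually hd] with t ht
    exact (ht.hasDerivAt.comp t (haff t)).congr_deriv (by ring)
  · filter_upwards [hl.eventually hd'] with t ht
    have h := (ht.hasDerivAt.comp t (haff t)).const_mul a
    exact h.congr_deriv (by ring)

/-! ### The gamma kernels in terms of the profile -/

lemma integral_eq_mul_integral_comp_affine {σ : ℝ} (hσ : σ = 1 ∨ σ = -1) {a : ℝ} (ha : 0 < a)
    (φ : ℝ → ℝ) : ∫ u, φ u = a * ∫ t, φ (a + a * σ * t) := by
  have h1 := Measure.integral_comp_mul_left (fun x => φ (a + x)) (a * σ)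
  have h2 : |(a * σ)⁻¹| = a⁻¹ := by
    rcases hσ with rfl | rfl <;> simp [abs_of_pos ha]
  rw [h1, h2, integral_add_left_eq_self, smul_eq_mul, mul_inv_cancel_left₀ ha.ne']

lemma integrable_comp_affine {f : ℝ → ℝ} (hf : Integrable f) {a b : ℝ} (ha : a ≠ 0) :
    Integrable (fun t => f (b + a * t)) := by
  have := (hf.comp_add_left b).comp_mul_left' ha
  exact this

lemma ae_ne_zero : ∀ᵐ t : ℝ, t ≠ 0 := by
  simp [ae_iff]

lemma gammaProfile_rpow_of_nonneg {σ : ℝ} (hσ : σ = 1 ∨ σ = -1) {s : ℝ} (hs : 0 ≤ s) (z : ℝ) :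
    gammaProfile σ (σ * (s - 1)) ^ z = s ^ z * Real.exp (-(s - 1) * z) := by
  have hσ2 : σ * (σ * (s - 1)) = s - 1 := by rcases hσ with rfl | rfl <;> ring
  rw [gammaProfile_rpow_eq, hσ2, add_sub_cancel, max_eq_right hs]

lemma rpow_mul_exp_neg_eq {σ z t : ℝ} (hz : 0 < z)
    (ht : 0 ≤ 1 + σ * t) :
    (z + z * σ * t) ^ z * Real.exp (-(z + z * σ * t)) =
      z ^ z * Real.exp (-z) * gammaProfile σ t ^ z := by
  rw [gammaProfile_rpow_eq, max_eq_right ht, show z + z * σ * t = z * (1 + σ * t) by ring,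
    Real.mul_rpow hz.le ht, show -(z * (1 + σ * t)) = -z + -(σ * t) * z by ring, Real.exp_add]
  ring

/-- Substitute `u = z(1 + σt)`. The set `S` is one side of the mode `z` within `u > 0`, up to the
null point `t = 0`; where `1 + σt ≤ 0` the profile vanishes. -/
lemma setIntegral_rpow_mul_exp_neg {σ : ℝ} (hσ : σ = 1 ∨ σ = -1) {z : ℝ} (hz : 0 < z) {S : Set ℝ}
    (hS : MeasurableSet S)
    (h1 : ∀ t ≠ 0, z + z * σ * t ∈ S ↔ 0 < t ∧ 0 < 1 + σ * t) :
    ∫ u in S, u ^ (z + 1 - 1) * Real.exp (-u) =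
      z ^ (z + 1) * Real.exp (-z) * profileMoment σ 0 z := by
  rw [← integral_indicator hS, integral_eq_mul_integral_comp_affine hσ hz, profileMoment_zero,
    ← integral_indicator measurableSet_Ioi, Real.rpow_add_one hz.ne',
    show z ^ z * z * Real.exp (-z) = z * (z ^ z * Real.exp (-z)) by ring, mul_assoc,
    ← integral_const_mul (z ^ z * Real.exp (-z))]
  congr 1
  refine integral_congr_ae ?_
  filter_upwards [ae_ne_zero] with t ht
  rcases lt_or_gt_of_ne ht with h | h
  · rw [Set.indicator_of_notMem (by rw [h1 t ht]; exact fun h' => h.not_gt h'.1),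
      Set.indicator_of_notMem (by simpa using h.le), mul_zero]
  rw [Set.indicator_of_mem (s := Set.Ioi 0) h]
  rcases le_or_gt (1 + σ * t) 0 with h2 | h2
  · rw [Set.indicator_of_notMem (by rw [h1 t ht]; exact fun h' => h2.not_gt h'.2),
      gammaProfile_rpow_eq, max_eq_left h2, Real.zero_rpow hz.ne']
    ring
  · rw [Set.indicator_of_mem ((h1 t ht).2 ⟨h, h2⟩), add_sub_cancel_right,
      rpow_mul_exp_neg_eq hz h2.le]

lemma lowerIncGamma_eq {z : ℝ} (hz : 0 < z) :
    lowerIncGamma (z + 1) z = z ^ (z + 1) * Real.exp (-z) * profileMoment (-1) 0 z := by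
  refine setIntegral_rpow_mul_exp_neg (Or.inr rfl) hz measurableSet_Ioc fun t ht => ?_
  have e : z + z * -1 * t = z * (1 + -1 * t) := by ring
  rw [Set.mem_Ioc, e, mul_pos_iff_of_pos_left hz, mul_le_iff_le_one_right hz]
  constructor
  · exact fun h => ⟨lt_of_le_of_ne (by linarith [h.2]) ht.symm, h.1⟩
  · exact fun h => ⟨h.2, by linarith [h.1]⟩

lemma upperIncGamma_eq {z : ℝ} (hz : 0 < z) :
    upperIncGamma (z + 1) z = z ^ (z + 1) * Real.exp (-z) * profileMoment 1 0 z := by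
  refine setIntegral_rpow_mul_exp_neg (Or.inl rfl) hz measurableSet_Ioi fun t ht => ?_
  rw [Set.mem_Ioi, mul_one, lt_add_iff_pos_right, mul_pos_iff_of_pos_left hz]
  exact ⟨fun h => ⟨h, by linarith⟩, fun h => h.1⟩

/-- The truncated and re-normalized gamma kernel, written in terms of its profile. -/
noncomputable def profileKernel (σ c z u : ℝ) : ℝ :=
  (c * profileMoment σ 0 z)⁻¹ *
    (Set.Ioi 0).indicator (fun t => gammaProfile σ t ^ z) (σ * (u / c - 1))

lemma profileKernel_eq_formula {σ : ℝ} (hσ : σ = 1 ∨ σ = -1) {c b u : ℝ} (hc : 0 < c)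
    (hb : 0 < b) (hu : 0 ≤ u) (hpos : 0 < σ * (u / c - 1)) {I : ℝ}
    (hI : I = (c / b) ^ (c / b + 1) * Real.exp (-(c / b)) * profileMoment σ 0 (c / b)) :
    profileKernel σ c (c / b) u =
      Real.Gamma (c / b + 1) / I * gammaKernelFormula c b u := by
  have hz : 0 < c / b := by positivity
  have hG : Real.Gamma (c / b + 1) ≠ 0 := (Real.Gamma_pos_of_pos (by linarith)).ne'
  rw [profileKernel, Set.indicator_of_mem (by exact hpos),
    gammaProfile_rpow_of_nonneg hσ (by positivity), hI, gammaKernelFormula]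
  have e1 : -(u / c - 1) * (c / b) = -u / b + c / b := by field_simp; ring
  rw [e1, Real.exp_add, Real.exp_neg (c / b), Real.div_rpow hu hc.le, Real.div_rpow hc.le hb.le,
    Real.rpow_add_one hc.ne', Real.rpow_add_one hb.ne']
  have hcz := Real.rpow_pos_of_pos hc (c / b)
  have hbz := Real.rpow_pos_of_pos hb (c / b)
  by_cases hM : profileMoment σ 0 (c / b) = 0
  · simp [hM]
  field_simp

lemma gammaKernelMinus_eq {c b u : ℝ} (hc : 0 < c) (hb : 0 < b) (hu : u ≠ c) :
    gammaKernelMinus c c b u = profileKernel (-1) c (c / b) u := by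
  have hz : 0 < c / b := by positivity
  rw [gammaKernelMinus, gammaKernelL]
  rcases lt_or_gt_of_ne hu with h | h
  · have h' : u / c < 1 := by rwa [div_lt_one hc]
    rcases lt_or_ge u 0 with h0 | h0
    -- For `u < 0` the point `t = 1 - u/c` is positive, so it is the cut-off in the profile, not the
    -- indicator, that gives zero.
    · rw [Set.indicator_of_notMem (by simpa using fun h' => absurd h' h0.not_ge), profileKernel,
        Set.indicator_of_mem (by rw [Set.mem_Ioi]; linarith), gammaProfile_rpow_eq,
        max_eq_left (by have := div_neg_of_neg_of_pos h0 hc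
                        linarith), Real.zero_rpow hz.ne']
      ring
    · rw [Set.indicator_of_mem (by exact ⟨h0, h⟩), profileKernel_eq_formula (Or.inr rfl) hc hb h0
        (by linarith) (lowerIncGamma_eq hz)]
  · have h' : 1 < u / c := by rwa [one_lt_div hc]
    rw [Set.indicator_of_notMem (by simpa using fun _ => h.le), profileKernel,
      Set.indicator_of_notMem (by rw [Set.mem_Ioi]; linarith), mul_zero, mul_zero]

/-- The point `u = c` is excluded because `Set.Ici c` contains it while `profileKernel` is cut to `t
> 0`. -/
lemma gammaKernelPlus_eq {c b u : ℝ} (hc : 0 < c) (hb : 0 < b) (hu : u ≠ c) :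
    gammaKernelPlus c c b u = profileKernel 1 c (c / b) u := by
  have hz : 0 < c / b := by positivity
  rw [gammaKernelPlus, gammaKernelU]
  rcases lt_or_gt_of_ne hu with h | h
  · have h' : u / c < 1 := by rwa [div_lt_one hc]
    rw [Set.indicator_of_notMem (by simpa using h), profileKernel,
      Set.indicator_of_notMem (by rw [Set.mem_Ioi]; linarith), mul_zero, mul_zero]
  · have h' : 1 < u / c := by rwa [one_lt_div hc]
    rw [Set.indicator_of_mem (by exact h.le), profileKernel_eq_formula (Or.inl rfl) hc hb
      (hc.trans h).le (by linarith) (upperIncGamma_eq hz)]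

lemma measurable_gammaKernelFormula (x b : ℝ) : Measurable (gammaKernelFormula x b) := by
  unfold gammaKernelFormula; fun_prop

lemma measurable_gammaKernelMinus (c x b : ℝ) : Measurable (gammaKernelMinus c x b) :=
  ((measurable_gammaKernelFormula x b).indicator measurableSet_Ico).const_mul _

lemma measurable_gammaKernelPlus (c x b : ℝ) : Measurable (gammaKernelPlus c x b) :=
  ((measurable_gammaKernelFormula x b).indicator measurableSet_Ici).const_mul _

lemma abs_profileKernel_le {σ c z : ℝ} (hz : 0 ≤ z) (u : ℝ) :
    |profileKernel σ c z u| ≤ |(c * profileMoment σ 0 z)⁻¹| := by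
  rw [profileKernel, abs_mul]
  refine mul_le_of_le_one_right (abs_nonneg _) ?_
  unfold Set.indicator
  split_ifs
  · rw [abs_of_nonneg (Real.rpow_nonneg (gammaProfile_nonneg _ _) _)]
    exact Real.rpow_le_one (gammaProfile_nonneg _ _) (gammaProfile_le_one _ _) hz
  · simp

lemma profileKernel_affine {σ : ℝ} (hσ : σ = 1 ∨ σ = -1) {c : ℝ} (hc : 0 < c) (z t : ℝ) :
    profileKernel σ c z (c + c * σ * t) = (c * profileMoment σ 0 z)⁻¹ *
      (Set.Ioi 0).indicator (fun t => gammaProfile σ t ^ z) t := by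
  have : σ * ((c + c * σ * t) / c - 1) = t := by
    have hσ2 : σ ^ 2 = 1 := by rcases hσ with rfl | rfl <;> norm_num
    field_simp
    linear_combination t * hσ2
  rw [profileKernel, this]

lemma integral_profileKernel_mul {σ : ℝ} (hσ : σ = 1 ∨ σ = -1) {c : ℝ} (hc : 0 < c) (z : ℝ)
    (f : ℝ → ℝ) :
    ∫ u, profileKernel σ c z u * f u = profileMean σ (fun t => f (c + c * σ * t)) z := by
  rw [integral_eq_mul_integral_comp_affine hσ hc, profileMean, ← integral_indicator measurableSet_Ioi]
  have e : ∀ t, profileKernel σ c z (c + c * σ * t) * f (c + c * σ * t) =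
      (c * profileMoment σ 0 z)⁻¹ * (Set.Ioi 0).indicator
        (fun t => gammaProfile σ t ^ z * f (c + c * σ * t)) t := fun t => by
    rw [profileKernel_affine hσ hc]
    unfold Set.indicator
    split_ifs <;> ring
  simp_rw [e]
  rw [integral_const_mul, mul_inv]
  field_simp

/-- The square of `q^z` is `q^(2z)`, so the second moment is an average at parameter `2z`,
renormalized. -/
lemma integral_profileKernel_sq_mul {σ : ℝ} (hσ : σ = 1 ∨ σ = -1) {c : ℝ} (hc : 0 < c) {z : ℝ}
    (hz : 1 ≤ z) (f : ℝ → ℝ) :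
    ∫ u, profileKernel σ c z u ^ 2 * f u = (c * profileMoment σ 0 z ^ 2)⁻¹ *
      (profileMoment σ 0 (2 * z) * profileMean σ (fun t => f (c + c * σ * t)) (2 * z)) := by
  have hM := profileMoment_zero_pos hσ
    (integrableOn_gammaProfile_rpow hσ (z := 2 * z) (by linarith))
  rw [integral_eq_mul_integral_comp_affine hσ hc, profileMean, mul_div_cancel₀ _ hM.ne',
    ← integral_indicator measurableSet_Ioi]
  have e : ∀ t, profileKernel σ c z (c + c * σ * t) ^ 2 * f (c + c * σ * t) =
      (c * profileMoment σ 0 z)⁻¹ ^ 2 * (Set.Ioi 0).indicator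
        (fun t => gammaProfile σ t ^ (2 * z) * f (c + c * σ * t)) t := fun t => by
    rw [profileKernel_affine hσ hc]
    have : gammaProfile σ t ^ (2 * z) = (gammaProfile σ t ^ z) ^ 2 := by
      rw [mul_comm, Real.rpow_mul (gammaProfile_nonneg _ _), Real.rpow_two]
    unfold Set.indicator
    split_ifs
    · simp only [this]; ring
    · ring
  simp_rw [e]
  rw [integral_const_mul, mul_inv, mul_inv]
  field_simp

/-! ### Mean and variance of sample averages -/

section Sample

variable {Ω : Type*} [MeasurableSpace Ω] {P : Measure Ω}
  {X : ℕ → Ω → ℝ} {f : ℝ → ℝ}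

lemma IsRandomSampleFrom.integral_comp (hX : IsRandomSampleFrom P X f) {K : ℝ → ℝ}
    (hK : Measurable K) (i : ℕ) : ∫ ω, K (X i ω) ∂P = ∫ u, K u * f u := by
  rw [← integral_map (hX.measurable_sample i).aemeasurable hK.aestronglyMeasurable, hX.law i,
    integral_withDensity_eq_integral_toReal_smul (by have := hX.measurable_density; fun_prop)
      (ae_of_all _ fun _ => ENNReal.ofReal_lt_top)]
  refine integral_congr_ae (ae_of_all _ fun u => ?_)
  simp only [ENNReal.toReal_ofReal (hX.density_nonneg u), smul_eq_mul, mul_comm]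

variable [IsProbabilityMeasure P]

lemma IsRandomSampleFrom.integrable_density (hX : IsRandomSampleFrom P X f) :
    Integrable f := by
  have h := congrArg (fun m : Measure ℝ => m Set.univ) (hX.law 0)
  simp only [Measure.map_apply (hX.measurable_sample 0) MeasurableSet.univ, Set.preimage_univ,
    measure_univ, withDensity_apply _ MeasurableSet.univ, Measure.restrict_univ] at h
  refine ⟨hX.measurable_density.aestronglyMeasurable, ?_⟩
  rw [hasFiniteIntegral_iff_ofReal (ae_of_all _ hX.density_nonneg), ← h]
  exact ENNReal.one_lt_top

lemma IsRandomSampleFrom.memLp_comp (hX : IsRandomSampleFrom P X f) {K : ℝ → ℝ}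
    (hK : Measurable K) {B : ℝ} (hB : ∀ u, |K u| ≤ B) (i : ℕ) :
    MemLp (fun ω => K (X i ω)) 2 P :=
  MemLp.of_bound (hK.comp (hX.measurable_sample i)).aestronglyMeasurable B
    (ae_of_all _ fun _ => hB _)

lemma IsRandomSampleFrom.memLp_average (hX : IsRandomSampleFrom P X f) {K : ℝ → ℝ}
    (hK : Measurable K) {B : ℝ} (hB : ∀ u, |K u| ≤ B) (n : ℕ) :
    MemLp (fun ω => 1 / (n : ℝ) * ∑ i ∈ Finset.range n, K (X i ω)) 2 P :=
  (memLp_finsetSum _ fun i _ => hX.memLp_comp hK hB i).const_mul _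

lemma IsRandomSampleFrom.integral_average (hX : IsRandomSampleFrom P X f) {K : ℝ → ℝ}
    (hK : Measurable K) {B : ℝ} (hB : ∀ u, |K u| ≤ B) {n : ℕ} (hn : n ≠ 0) :
    ∫ ω, 1 / (n : ℝ) * ∑ i ∈ Finset.range n, K (X i ω) ∂P = ∫ u, K u * f u := by
  rw [integral_const_mul, integral_finsetSum _ fun i _ =>
    (hX.memLp_comp hK hB i).integrable one_le_two]
  simp_rw [hX.integral_comp hK]
  simp [hn]

lemma IsRandomSampleFrom.variance_average (hX : IsRandomSampleFrom P X f) {K : ℝ → ℝ}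
    (hK : Measurable K) {B : ℝ} (hB : ∀ u, |K u| ≤ B) {n : ℕ} (hn : n ≠ 0) :
    variance (fun ω => 1 / (n : ℝ) * ∑ i ∈ Finset.range n, K (X i ω)) P =
      1 / (n : ℝ) * ((∫ u, K u ^ 2 * f u) - (∫ u, K u * f u) ^ 2) := by
  have hv : ∀ i, variance (fun ω => K (X i ω)) P =
      (∫ u, K u ^ 2 * f u) - (∫ u, K u * f u) ^ 2 := fun i => by
    rw [variance_eq_sub (hX.memLp_comp hK hB i), hX.integral_comp hK]
    congr 1
    exact hX.integral_comp (hK.pow_const 2) i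
  have hs := IndepFun.variance_sum (X := fun i ω => K (X i ω)) (s := Finset.range n) (μ := P)
    (fun i _ => hX.memLp_comp hK hB i)
    (fun i _ j _ hij => (hX.indep.indepFun hij).comp hK hK)
  rw [variance_const_mul]
  have e : (fun ω => ∑ i ∈ Finset.range n, K (X i ω)) =
      ∑ i ∈ Finset.range n, fun ω => K (X i ω) := by
    funext ω; simp
  rw [e, hs]
  simp_rw [hv]
  simp only [Finset.sum_const, Finset.card_range, nsmul_eq_mul]
  field_simp

end Sample

/-! ### From an `o(b)` remainder to a ratio -/

/-- If `f₁ ≠ 0` the `√b` term dominates and the limit is `0`; if `f₁ = 0` the expansion is `(c/2) f₂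
b`. Either way an `o(b)` error is negligible against the expansion. -/
lemma exists_tendsto_div_biasExpansion {s c f₁ f₂ : ℝ} (hs : s = 1 ∨ s = -1) (hc : 0 < c)
    (hf : f₁ ≠ 0 ∨ f₂ ≠ 0) :
    ∃ l, Tendsto (fun b => b / biasExpansion s c f₁ f₂ b) (𝓝[>] 0) (𝓝 l) ∧
      ∀ᶠ b in 𝓝[>] 0, biasExpansion s c f₁ f₂ b ≠ 0 := by
  have hπ := Real.pi_pos
  set A := s * √(2 / Real.pi) * √c * f₁ with hA
  set B := (1 - 4 / (3 * Real.pi)) * f₁ + c / 2 * f₂ with hB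
  have hexp : ∀ b, biasExpansion s c f₁ f₂ b = A * √b + B * b := fun b => rfl
  simp_rw [hexp]
  have hpos : ∀ᶠ b : ℝ in 𝓝[>] 0, 0 < b := eventually_mem_nhdsWithin
  by_cases h1 : f₁ = 0
  · have hA0 : A = 0 := by rw [hA, h1, mul_zero]
    have hB0 : B ≠ 0 := by
      have h2 : f₂ ≠ 0 := by tauto
      rw [hB, h1, mul_zero, zero_add]
      positivity
    refine ⟨B⁻¹, tendsto_const_nhds.congr' ?_, ?_⟩
    · filter_upwards [hpos] with b hb
      rw [hA0]
      field_simp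
      simp
    · filter_upwards [hpos] with b hb
      rw [hA0, zero_mul, zero_add]
      positivity
  · have hA0 : A ≠ 0 := by
      have hs0 : s ≠ 0 := by rcases hs with rfl | rfl <;> norm_num
      have := Real.sqrt_pos.2 hc
      have : 0 < √(2 / Real.pi) := by positivity
      positivity
    have hsq : Tendsto (fun b : ℝ => √b) (𝓝[>] 0) (𝓝 0) := by
      have := (Real.continuous_sqrt.tendsto 0).mono_left
        (nhdsWithin_le_nhds (a := (0 : ℝ)) (s := Set.Ioi 0))
      simpa using this
    have hden : Tendsto (fun b : ℝ => A + B * √b) (𝓝[>] 0) (𝓝 A) := by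
      simpa using (hsq.const_mul B).const_add A
    have hfac : ∀ᶠ b : ℝ in 𝓝[>] 0, A * √b + B * b = √b * (A + B * √b) := by
      filter_upwards [hpos] with b hb
      have := Real.mul_self_sqrt hb.le
      linear_combination (-B) * this
    refine ⟨0 / A, (hsq.div hden hA0).congr' ?_, ?_⟩
    · filter_upwards [hpos, hfac, hden.eventually_ne hA0] with b hb he hn
      have hsb : 0 < √b := by positivity
      rw [he]
      simp only [Pi.div_apply]
      nth_rewrite 3 [← Real.mul_self_sqrt hb.le]
      field_simp
    · filter_upwards [hpos, hfac, hden.eventually_ne hA0] with b hb he hn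
      have hsb : 0 < √b := by positivity
      rw [he]
      exact mul_ne_zero hsb.ne' hn

lemma tendsto_div_biasExpansion_of_isLittleO {s c f₁ f₂ : ℝ} (hs : s = 1 ∨ s = -1) (hc : 0 < c)
    (hf : f₁ ≠ 0 ∨ f₂ ≠ 0) {b bias : ℕ → ℝ} (hb : Tendsto b atTop (𝓝[>] 0))
    (h : (fun n => bias n - biasExpansion s c f₁ f₂ (b n)) =o[atTop] b) :
    Tendsto (fun n => bias n / biasExpansion s c f₁ f₂ (b n)) atTop (𝓝 1) := by
  obtain ⟨l, hl, hne⟩ := exists_tendsto_div_biasExpansion hs hc hf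
  have h2 := (h.tendsto_div_nhds_zero.mul (hl.comp hb)).add_const 1
  rw [zero_mul, zero_add] at h2
  refine h2.congr' ?_
  have hpos : ∀ᶠ n in atTop, 0 < b n := hb.eventually eventually_mem_nhdsWithin
  filter_upwards [hb.eventually hne, hpos] with n hn hp
  simp only [Function.comp_apply]
  field_simp
  ring

/-! ### Bias and variance for a kernel equal to the profile kernel off `c` -/

section Estimator

variable {Ω : Type*} [MeasurableSpace Ω] {P : Measure Ω} [IsProbabilityMeasure P]
  {X : ℕ → Ω → ℝ} {f : ℝ → ℝ} {σ c : ℝ} {K : ℝ → ℝ → ℝ}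

lemma exists_bound_of_eq_profileKernel (hc : 0 < c)
    (hK : ∀ b > 0, ∀ u ≠ c, K b u = profileKernel σ c (c / b) u) {b : ℝ} (hb : 0 < b) :
    ∃ B, ∀ u, |K b u| ≤ B := by
  refine ⟨max |(c * profileMoment σ 0 (c / b))⁻¹| |K b c|, fun u => ?_⟩
  by_cases hu : u = c
  · rw [hu]; exact le_max_right _ _
  · rw [hK b hb u hu]
    exact (abs_profileKernel_le (by positivity) u).trans (le_max_left _ _)

lemma ae_eq_profileKernel (hK : ∀ b > 0, ∀ u ≠ c, K b u = profileKernel σ c (c / b) u) {b : ℝ}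
    (hb : 0 < b) : ∀ᵐ u, K b u = profileKernel σ c (c / b) u := by
  have : ∀ᵐ u : ℝ, u ≠ c := by simp [ae_iff]
  filter_upwards [this] with u hu using hK b hb u hu

lemma integral_kernel_mul (hσ : σ = 1 ∨ σ = -1) (hc : 0 < c)
    (hK : ∀ b > 0, ∀ u ≠ c, K b u = profileKernel σ c (c / b) u) {b : ℝ} (hb : 0 < b) :
    ∫ u, K b u * f u = profileMean σ (fun t => f (c + c * σ * t)) (c / b) := by
  rw [← integral_profileKernel_mul hσ hc]
  refine integral_congr_ae ?_
  filter_upwards [ae_eq_profileKernel hK hb] with u hu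
  rw [hu]

lemma integral_kernel_sq_mul (hσ : σ = 1 ∨ σ = -1) (hc : 0 < c)
    (hK : ∀ b > 0, ∀ u ≠ c, K b u = profileKernel σ c (c / b) u) {b : ℝ} (hb : 0 < b)
    (hbc : 1 ≤ c / b) :
    ∫ u, K b u ^ 2 * f u = (c * profileMoment σ 0 (c / b) ^ 2)⁻¹ *
      (profileMoment σ 0 (2 * (c / b)) *
        profileMean σ (fun t => f (c + c * σ * t)) (2 * (c / b))) := by
  rw [← integral_profileKernel_sq_mul hσ hc hbc]
  refine integral_congr_ae ?_
  filter_upwards [ae_eq_profileKernel hK hb] with u hu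
  rw [hu]

lemma tendsto_const_div_atTop {b : ℕ → ℝ} (hc : 0 < c) (hb : Tendsto b atTop (𝓝[>] 0)) :
    Tendsto (fun n => c / b n) atTop atTop := by
  simp_rw [div_eq_mul_inv]
  exact (tendsto_inv_nhdsGT_zero.comp hb).const_mul_atTop hc

theorem isLittleO_bias (hX : IsRandomSampleFrom P X f) (hσ : σ = 1 ∨ σ = -1) (hc : 0 < c)
    (hKm : ∀ b, Measurable (K b))
    (hK : ∀ b > 0, ∀ u ≠ c, K b u = profileKernel σ c (c / b) u) {f₀ f₁ f₂ : ℝ}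
    (ho : (fun t => f (c + c * σ * t) - (f₀ + c * σ * f₁ * t + (c * σ) ^ 2 * f₂ / 2 * t ^ 2))
      =o[𝓝[>] 0] fun t => t ^ 2)
    {b : ℕ → ℝ} (hb_pos : ∀ n, 0 < b n) (hb : Tendsto b atTop (𝓝[>] 0)) :
    (fun n : ℕ => ((∫ ω, 1 / (n : ℝ) * ∑ i ∈ Finset.range n, K (b n) (X i ω) ∂P) - f₀) -
      biasExpansion σ c f₁ f₂ (b n)) =o[atTop] b := by
  have hσ2 : σ ^ 2 = 1 := by rcases hσ with rfl | rfl <;> norm_num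
  have hg : IntegrableOn (fun t => f (c + c * σ * t)) (Set.Ioi 0) :=
    (integrable_comp_affine hX.integrable_density
      (mul_ne_zero hc.ne' (by rcases hσ with rfl | rfl <;> norm_num))).integrableOn
  have h := ((tendsto_mul_profileMean_sub hσ hg ho).comp
    (tendsto_const_div_atTop hc hb)).sub_const
      (σ * (1 - 4 / (3 * Real.pi)) * (c * σ * f₁) + (c * σ) ^ 2 * f₂ / 2)
  -- Since `z = c/b`, this factor turns multiplication by `z` into division by `b`.
  have h := h.const_mul c⁻¹
  rw [sub_self, mul_zero] at h
  rw [isLittleO_iff_tendsto' (Eventually.of_forall fun n h0 => absurd h0 (hb_pos n).ne')]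
  refine h.congr' ?_
  filter_upwards [eventually_ne_atTop 0] with n hn
  obtain ⟨B, hB⟩ := exists_bound_of_eq_profileKernel hc hK (hb_pos n)
  rw [hX.integral_average (hKm _) hB hn, integral_kernel_mul hσ hc hK (hb_pos n), biasExpansion]
  simp only [Function.comp_apply]
  generalize profileMean σ (fun t => f (c + c * σ * t)) (c / b n) = m
  have hbn := hb_pos n
  have hsb : 0 < √(b n) := by positivity
  have hsc : 0 < √c := by positivity
  rw [Real.sqrt_div hc.le]
  have hbs : b n = √(b n) ^ 2 := (Real.sq_sqrt hbn.le).symm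
  have hcs : c = √c ^ 2 := (Real.sq_sqrt hc.le).symm
  generalize √(b n) = y at *
  rw [hbs]
  generalize √(2 / Real.pi) = κ
  have hπ := Real.pi_pos
  field_simp
  simp only [hσ2]
  ring

/-- After normalization the second moment tends to `1`, from `M_0(2z) ~ √(π/(4z))` and `M_0(z)² ~
π/(2z)`; the squared mean stays bounded and carries a factor `√b → 0`. -/
theorem tendsto_variance_div (hX : IsRandomSampleFrom P X f) (hσ : σ = 1 ∨ σ = -1) (hc : 0 < c)
    (hKm : ∀ b, Measurable (K b))
    (hK : ∀ b > 0, ∀ u ≠ c, K b u = profileKernel σ c (c / b) u) {f₀ g₁ g₂ : ℝ} (hf₀ : 0 < f₀)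
    (ho : (fun t => f (c + c * σ * t) - (f₀ + g₁ * t + g₂ * t ^ 2)) =o[𝓝[>] 0] fun t => t ^ 2)
    {b : ℕ → ℝ} (hb_pos : ∀ n, 0 < b n) (hb : Tendsto b atTop (𝓝[>] 0)) :
    Tendsto (fun n : ℕ =>
      variance (fun ω => 1 / (n : ℝ) * ∑ i ∈ Finset.range n, K (b n) (X i ω)) P /
        (1 / ((n : ℝ) * √(b n)) * (f₀ / (√Real.pi * √c)))) atTop (𝓝 1) := by
  have hπ := Real.pi_pos
  have hg : IntegrableOn (fun t => f (c + c * σ * t)) (Set.Ioi 0) :=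
    (integrable_comp_affine hX.integrable_density
      (mul_ne_zero hc.ne' (by rcases hσ with rfl | rfl <;> norm_num))).integrableOn
  set g : ℝ → ℝ := fun t => f (c + c * σ * t) with hgdef
  have hz := tendsto_const_div_atTop hc hb
  have hz2 : Tendsto (fun n => 2 * (c / b n)) atTop atTop := hz.const_mul_atTop two_pos
  have hA := tendsto_profileMean hσ hg ho
  have hM := tendsto_sqrt_mul_profileMoment_zero hσ
  have hsb : Tendsto (fun n => √(b n)) atTop (𝓝 0) := by
    have := (Real.continuous_sqrt.tendsto 0).comp (hb.mono_right nhdsWithin_le_nhds)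
    rwa [Real.sqrt_zero] at this
  have hmain := ((((hM.comp hz2).mul (hA.comp hz2)).div ((hM.comp hz).pow 2)
    (by positivity)).const_mul (√Real.pi / √2 / f₀)).sub
      ((hsb.mul ((hA.comp hz).pow 2)).const_mul (√Real.pi * √c / f₀))
  have hlim : √Real.pi / √2 / f₀ * (√(Real.pi / 2) * f₀ / √(Real.pi / 2) ^ 2) -
      √Real.pi * √c / f₀ * (0 * f₀ ^ 2) = 1 := by
    rw [Real.sqrt_div hπ.le]
    have : 0 < √Real.pi := by positivity
    field_simp
    ring
  rw [hlim] at hmain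
  refine hmain.congr' ?_
  filter_upwards [eventually_ne_atTop 0, hz.eventually_ge_atTop 1] with n hn hz1
  obtain ⟨B, hB⟩ := exists_bound_of_eq_profileKernel hc hK (hb_pos n)
  have hbn := hb_pos n
  rw [hX.variance_average (hKm _) hB hn, integral_kernel_mul hσ hc hK hbn,
    integral_kernel_sq_mul hσ hc hK hbn hz1]
  have hM0 := profileMoment_zero_pos hσ (integrableOn_gammaProfile_rpow hσ hz1)
  simp only [Function.comp_apply, Pi.div_apply]
  rw [← hgdef]
  generalize profileMean σ g (c / b n) = m
  generalize profileMean σ g (2 * (c / b n)) = m2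
  generalize profileMoment σ 0 (2 * (c / b n)) = M2
  generalize profileMoment σ 0 (c / b n) = M1 at *
  have hsbn : 0 < √(b n) := by positivity
  have hsc : 0 < √c := by positivity
  have hspi : 0 < √Real.pi := by positivity
  have hn' : (n : ℝ) ≠ 0 := Nat.cast_ne_zero.2 hn
  rw [Real.sqrt_mul two_pos.le, Real.sqrt_div hc.le]
  have hcs : √c ^ 2 = c := Real.sq_sqrt hc.le
  have e : (c * M1 ^ 2)⁻¹ = (√c ^ 2 * M1 ^ 2)⁻¹ := by rw [hcs]
  rw [e]
  field_simp

end Estimator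

/-! ### The two sides of `c` -/

theorem proposition1 {Ω : Type*} [MeasurableSpace Ω] (P : Measure Ω) [IsProbabilityMeasure P]
    (X : ℕ → Ω → ℝ) (f : ℝ → ℝ) (c : ℝ) (hc : 0 < c)
    (hX : IsRandomSampleFrom P X f)
    (hf : HasPiecewiseHolderSecondDeriv f c)
    -- the one-sided limits at `c` of the density and of its first two derivatives
    (fm fm₁ fm₂ fp fp₁ fp₂ : ℝ)
    (hfm : Tendsto f (𝓝[<] c) (𝓝 fm))
    (hfm₁ : Tendsto (deriv f) (𝓝[<] c) (𝓝 fm₁))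
    (hfm₂ : Tendsto (iteratedDeriv 2 f) (𝓝[<] c) (𝓝 fm₂))
    (hfp : Tendsto f (𝓝[>] c) (𝓝 fp))
    (hfp₁ : Tendsto (deriv f) (𝓝[>] c) (𝓝 fp₁))
    (hfp₂ : Tendsto (iteratedDeriv 2 f) (𝓝[>] c) (𝓝 fp₂))
    (hfm_pos : 0 < fm) (hfp_pos : 0 < fp)
    -- the smoothing parameter
    (b : ℕ → ℝ) (hb_pos : ∀ n, 0 < b n)
    (hb : Tendsto (fun n : ℕ => b n + ((n : ℝ) * b n)⁻¹) atTop (𝓝 0)) :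
    -- the estimators have finite second moments, so mean and variance make sense
    (∀ n, MemLp (fHatMinus X c (b n) n) 2 P ∧ MemLp (fHatPlus X c (b n) n) 2 P) ∧
    -- bias, up to a remainder of smaller order than `b`
    ((fun n => ((∫ ω, fHatMinus X c (b n) n ω ∂P) - fm) - biasExpansion (-1) c fm₁ fm₂ (b n))
      =o[atTop] b) ∧
    ((fun n => ((∫ ω, fHatPlus X c (b n) n ω ∂P) - fp) - biasExpansion 1 c fp₁ fp₂ (b n))
      =o[atTop] b) ∧
    -- bias, as an asymptotic equivalence whenever the expansion does not vanish identically
    (fm₁ ≠ 0 ∨ fm₂ ≠ 0 →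
      Tendsto (fun n => ((∫ ω, fHatMinus X c (b n) n ω ∂P) - fm) /
        biasExpansion (-1) c fm₁ fm₂ (b n)) atTop (𝓝 1)) ∧
    (fp₁ ≠ 0 ∨ fp₂ ≠ 0 →
      Tendsto (fun n => ((∫ ω, fHatPlus X c (b n) n ω ∂P) - fp) /
        biasExpansion 1 c fp₁ fp₂ (b n)) atTop (𝓝 1)) ∧
    -- variance
    Tendsto (fun n => variance (fHatMinus X c (b n) n) P /
      (1 / ((n : ℝ) * √(b n)) * (fm / (√Real.pi * √c)))) atTop (𝓝 1) ∧
    Tendsto (fun n => variance (fHatPlus X c (b n) n) P /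
      (1 / ((n : ℝ) * √(b n)) * (fp / (√Real.pi * √c)))) atTop (𝓝 1) := by
  have hb0 : Tendsto b atTop (𝓝[>] 0) := by
    refine tendsto_nhdsWithin_iff.2 ⟨?_, Eventually.of_forall hb_pos⟩
    refine squeeze_zero (fun n => (hb_pos n).le) (fun n => le_add_of_nonneg_right ?_) hb
    have := hb_pos n
    positivity
  obtain ⟨hd, hd', -⟩ := hf
  have hopen : IsOpen (Set.Ioo 0 c ∪ Set.Ioi c) := isOpen_Ioo.union isOpen_Ioi
  have hL : ∀ᶠ x in 𝓝[<] c, Set.Ioo 0 c ∪ Set.Ioi c ∈ 𝓝 x := by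
    filter_upwards [Ioo_mem_nhdsLT hc] with x hx using hopen.mem_nhds (Or.inl hx)
  have hR : ∀ᶠ x in 𝓝[>] c, Set.Ioo 0 c ∪ Set.Ioi c ∈ 𝓝 x := by
    filter_upwards [self_mem_nhdsWithin] with x hx using hopen.mem_nhds (Or.inr hx)
  have hlim : ∀ a : ℝ, Tendsto (fun t => c + a * t) (𝓝[>] 0) (𝓝 c) := fun a => by
    have : Continuous fun t => c + a * t := by fun_prop
    have h0 := this.tendsto 0
    rw [mul_zero, add_zero] at h0
    exact h0.mono_left nhdsWithin_le_nhds
  -- The left side is traversed backwards: `t → 0+` means `u = c - ct` increases to `c`, hence the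
  -- sign of the first-order term.
  have hlL : Tendsto (fun t => c + c * -1 * t) (𝓝[>] 0) (𝓝[<] c) := by
    refine tendsto_nhdsWithin_iff.2 ⟨hlim _, ?_⟩
    filter_upwards [self_mem_nhdsWithin] with t (ht : 0 < t)
    have := mul_pos hc ht
    rw [Set.mem_Iio]
    linarith
  have hlR : Tendsto (fun t => c + c * 1 * t) (𝓝[>] 0) (𝓝[>] c) := by
    refine tendsto_nhdsWithin_iff.2 ⟨hlim _, ?_⟩
    filter_upwards [self_mem_nhdsWithin] with t (ht : 0 < t)
    have := mul_pos hc ht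
    rw [Set.mem_Ioi]
    linarith
  have hoL := isLittleO_taylor_two_comp_affine hlL (hL.mono fun x hx => hd.differentiableAt hx)
    (hL.mono fun x hx => hd'.differentiableAt hx) hfm hfm₁ hfm₂
  have hoR := isLittleO_taylor_two_comp_affine hlR (hR.mono fun x hx => hd.differentiableAt hx)
    (hR.mono fun x hx => hd'.differentiableAt hx) hfp hfp₁ hfp₂
  have hmL := measurable_gammaKernelMinus c c
  have hmR := measurable_gammaKernelPlus c c
  have hKL : ∀ b > 0, ∀ u ≠ c, gammaKernelMinus c c b u = profileKernel (-1) c (c / b) u :=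
    fun b hb u hu => gammaKernelMinus_eq hc hb hu
  have hKR : ∀ b > 0, ∀ u ≠ c, gammaKernelPlus c c b u = profileKernel 1 c (c / b) u :=
    fun b hb u hu => gammaKernelPlus_eq hc hb hu
  have hbiasL := isLittleO_bias hX (Or.inr rfl) hc hmL hKL hoL hb_pos hb0
  have hbiasR := isLittleO_bias hX (Or.inl rfl) hc hmR hKR hoR hb_pos hb0
  refine ⟨fun n => ⟨?_, ?_⟩, hbiasL, hbiasR,
    fun h => tendsto_div_biasExpansion_of_isLittleO (Or.inr rfl) hc h hb0 hbiasL,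
    fun h => tendsto_div_biasExpansion_of_isLittleO (Or.inl rfl) hc h hb0 hbiasR,
    tendsto_variance_div hX (Or.inr rfl) hc hmL hKL hfm_pos hoL hb_pos hb0,
    tendsto_variance_div hX (Or.inl rfl) hc hmR hKR hfp_pos hoR hb_pos hb0⟩
  · obtain ⟨B, hB⟩ := exists_bound_of_eq_profileKernel hc hKL (hb_pos n)
    exact hX.memLp_average (hmL _) hB n
  · obtain ⟨B, hB⟩ := exists_bound_of_eq_profileKernel hc hKR (hb_pos n)
    exact hX.memLp_average (hmR _) hB n
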